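/- Let $(\mathcal C,\otimes,I)$ be a symmetric monoidal category in which every coreflexive pair (a parallel pair of morphisms with a common retraction) has an equalizer, such that these equalizers are preserved by $X\otimes -$ and $-\otimes X$ for every object $X$, and which has finite coproducts. Notation. Let $\mathrm{CComon}$ be the category of commutative comonoids in $\mathcal C$ and, for $A\in\mathrm{CComon}$, let $\mathrm{Comod}_A$ be the category of $A$-comodules in $\mathcal C$. For a morphism $p\colon M\to B$ in $\mathrm{CComon}$ and a $B$-comodule $N$, the extension of scalars of $N$ is the $M$-comodule $N\otimes_B M:=\mathrm{eq}(N\otimes M\rightrightarrows N\otimes B\otimes M)$; restriction of scalars along $p$ turns an $M$-comodule into a $B$-comodule by composing its coaction with $p$. The category $\mathrm{CComon}$ has pullbacks; put $\mathrm{CCoalg}_A:=\mathrm{CComon}/A$. A span $A\xleftarrow{\,l\,}M\xrightarrow{\,r\,}B$ in $\mathrm{CComon}$ induces functors $M\otimes_B-\colon \mathrm{Comod}_B\to\mathrm{Comod}_A$ (extend scalars along $r$, then restrict along $l$) and $M\otimes_B-\colon \mathrm{CCoalg}_B\to\mathrm{CCoalg}_A$ (pull back along $r$, then compose with $l$). With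 their canonical coherence isomorphisms these make $\mathrm{CCoalg}$ and $\mathrm{Comod}$ contravariant pseudofunctors from the bicategory of spans in $\mathrm{CComon}$ (composition by pullback) to categories. The category $\mathrm{DLens}_{\mathcal C,\otimes}$ of dependent monoidal lenses has as objects the triples $(X,X')^A$ with $A\in\mathrm{CComon}$, $X\in\mathrm{CCoalg}_A$, $X'\in\mathrm{Comod}_A$, and as morphisms $$\mathrm{DLens}_{\mathcal C,\otimes}\big((X,X')^A,(Y,Y')^B\big)=\int^{A\leftarrow M\to B}\mathrm{CCoalg}_A(X,\,M\otimes_B Y)\times\mathrm{Comod}_A(M\otimes_B Y',\,X'),$$ the coend being over the category of spans from $A$ to $B$. The identity of $(X,X')^A$ is represented by the identity span and the unit isomorphisms $X\cong A\otimes_A X$, $A\otimes_A X'\cong X'$. The composite of $\langle l\mid r\rangle$ with representative $M$, from $(X,X')^A$ to $(Y,Y')^B$, and $\langle l_1\mid r_1\rangle$ with representative $N$, from $(Y,Y')^B$ to $(Z,Z')^D$, has as representative the composite span $M\otimes_B N$, with components $X\xrightarrow{l}M\otimes_B Y\xrightarrow{M\otimes_B l_1}M\otimes_B(N\otimes_D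 Z)\cong(M\otimes_B N)\otimes_D Z$ and $(M\otimes_B N)\otimes_D Z'\cong M\otimes_B(N\otimes_D Z')\xrightarrow{M\otimes_B r_1}M\otimes_B Y'\xrightarrow{r}X'$. Proposition. Assume that for every finite family $(A_i)_{i\in I}$ of commutative comonoids (the empty family included) and every coproduct $A=\coprod_{i\in I}A_i$ in $\mathrm{CComon}$, the functor $$\mathrm{Comod}_A\longrightarrow\prod_{i\in I}\mathrm{Comod}_{A_i},\qquad M\longmapsto (M\otimes_A A_i)_{i\in I},$$ is an equivalence of categories. Then $\mathrm{DLens}_{\mathcal C,\otimes}$ has finite coproducts. -/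

import Mathlib

open CategoryTheory Limits Opposite

universe w v v₁ v₂ u u₁ u₂

set_option linter.unusedSectionVars false

/-- The objects of the bicategory of spans in `S`. -/
structure SpanCat (S : Type u) where
  /-- The underlying object of `S`. -/
  as : S

namespace SpanCat

variable {S : Type u} [Category.{v} S] [HasPullbacks S]

noncomputable instance : CategoryStruct (SpanCat S) where
  Hom A B := Span (⊤ : MorphismProperty S) ⊤ A.as B.as
  id A := Span.id A.as
  comp f g := Span.comp f g

instance homCat (A B : SpanCat S) : Category (A ⟶ B) :=
  inferInstanceAs (Category (Span (⊤ : MorphismProperty S) ⊤ A.as B.as))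

/-- The apex of a span. -/
def apex {A B : SpanCat S} (f : A ⟶ B) : S := Span.apex f

/-- The left leg of a span. -/
def left {A B : SpanCat S} (f : A ⟶ B) : apex f ⟶ A.as := Span.l f

/-- The right leg of a span. -/
def right {A B : SpanCat S} (f : A ⟶ B) : apex f ⟶ B.as := Span.r f

/-- The map of apices underlying a morphism of spans. -/
def top {A B : SpanCat S} {f g : A ⟶ B} (m : f ⟶ g) : apex f ⟶ apex g := Span.Hom.hom m

section
variable {A B C : SpanCat S}

@[ext] lemma hom₂_ext {f g : A ⟶ B} {m n : f ⟶ g} (h : top m = top n) : m = n := Span.hom_ext h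

@[simp] lemma top_id (f : A ⟶ B) : top (𝟙 f) = 𝟙 _ := (rfl)

@[simp] lemma top_comp {f g h : A ⟶ B} (m : f ⟶ g) (n : g ⟶ h) :
    top (m ≫ n) = top m ≫ top n := (rfl)

@[simp] lemma top_left {f g : A ⟶ B} (m : f ⟶ g) :
    top m ≫ left g = left f := Span.Hom.hom_l m

@[simp] lemma top_left_assoc : type_of% (reassoc_of% @top_left) :=
  @(reassoc_of% @top_left)

@[simp] lemma top_right {f g : A ⟶ B} (m : f ⟶ g) :
    top m ≫ right g = right f := Span.Hom.hom_r m

@[simp] lemma top_right_assoc : type_of% (reassoc_of% @top_right) :=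
  @(reassoc_of% @top_right)

/-- The span with given legs. -/
def mkSpan {X : S} (l : X ⟶ A.as) (r : X ⟶ B.as) : A ⟶ B := Span.mk X l r trivial trivial

/-- The morphism of spans given by a morphism of apices compatible with the legs. -/
def mkHom {f g : A ⟶ B} (m : apex f ⟶ apex g)
    (hl : m ≫ left g = left f) (hr : m ≫ right g = right f) : f ⟶ g :=
  Span.Hom.mk m hl hr

@[simp] lemma top_mkHom {f g : A ⟶ B} (m : apex f ⟶ apex g)
    (hl : m ≫ left g = left f) (hr : m ≫ right g = right f) : top (mkHom m hl hr) = m := (rfl)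

/-- The isomorphism of spans given by an isomorphism of apices compatible with the legs. -/
@[simps] def mkIso {f g : A ⟶ B} (m : apex f ⟶ apex g) (n : apex g ⟶ apex f)
    (hl : m ≫ left g = left f) (hr : m ≫ right g = right f)
    (hmn : m ≫ n = 𝟙 _) (hnm : n ≫ m = 𝟙 _) : f ≅ g where
  hom := mkHom m hl hr
  inv := mkHom n (by rw [← hl, reassoc_of% hnm]) (by rw [← hr, reassoc_of% hnm])
  hom_inv_id := by ext; simpa
  inv_hom_id := by ext; simpa

/-- The apex of a composite span is a pullback: first projection. -/
noncomputable def p₁ (f : A ⟶ B) (g : B ⟶ C) : apex (f ≫ g) ⟶ apex f :=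
  pullback.fst (right f) (left g)

/-- The apex of a composite span is a pullback: second projection. -/
noncomputable def p₂ (f : A ⟶ B) (g : B ⟶ C) : apex (f ≫ g) ⟶ apex g :=
  pullback.snd (right f) (left g)

lemma isPullback (f : A ⟶ B) (g : B ⟶ C) : IsPullback (p₁ f g) (p₂ f g) (right f) (left g) :=
  IsPullback.of_hasPullback _ _

lemma condition (f : A ⟶ B) (g : B ⟶ C) :
    p₁ f g ≫ right f = p₂ f g ≫ left g := pullback.condition

lemma condition_assoc : type_of% (reassoc_of% @condition) :=
  @(reassoc_of% @condition)

@[simp] lemma comp_left (f : A ⟶ B) (g : B ⟶ C) :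
    left (f ≫ g) = p₁ f g ≫ left f := (rfl)

@[simp] lemma comp_left_assoc : type_of% (reassoc_of% @comp_left) :=
  @(reassoc_of% @comp_left)

@[simp] lemma comp_right (f : A ⟶ B) (g : B ⟶ C) :
    right (f ≫ g) = p₂ f g ≫ right g := (rfl)

@[simp] lemma comp_right_assoc : type_of% (reassoc_of% @comp_right) :=
  @(reassoc_of% @comp_right)

/-- Maps into the apex of a composite span. -/
noncomputable def lift {f : A ⟶ B} {g : B ⟶ C} {X : S} (a : X ⟶ apex f) (b : X ⟶ apex g)
    (h : a ≫ right f = b ≫ left g) : X ⟶ apex (f ≫ g) := pullback.lift a b h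

@[simp] lemma lift_p₁ {f : A ⟶ B} {g : B ⟶ C} {X : S} (a : X ⟶ apex f)
    (b : X ⟶ apex g) (h : a ≫ right f = b ≫ left g) : lift a b h ≫ p₁ f g = a :=
  pullback.lift_fst _ _ _

@[simp] lemma lift_p₁_assoc : type_of% (reassoc_of% @lift_p₁) :=
  @(reassoc_of% @lift_p₁)

@[simp] lemma lift_p₂ {f : A ⟶ B} {g : B ⟶ C} {X : S} (a : X ⟶ apex f)
    (b : X ⟶ apex g) (h : a ≫ right f = b ≫ left g) : lift a b h ≫ p₂ f g = b :=
  pullback.lift_snd _ _ _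

@[simp] lemma lift_p₂_assoc : type_of% (reassoc_of% @lift_p₂) :=
  @(reassoc_of% @lift_p₂)

lemma apex_ext {f : A ⟶ B} {g : B ⟶ C} {X : S} {a b : X ⟶ apex (f ≫ g)}
    (h₁ : a ≫ p₁ f g = b ≫ p₁ f g) (h₂ : a ≫ p₂ f g = b ≫ p₂ f g) : a = b :=
  pullback.hom_ext h₁ h₂

/-- The inverse of the left leg of the identity span. -/
def idInv (A : SpanCat S) : A.as ⟶ apex (𝟙 A) := 𝟙 A.as

@[simp] lemma idInv_left (A : SpanCat S) : idInv A ≫ left (𝟙 A) = 𝟙 _ :=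
  Category.id_comp (𝟙 A.as)

@[simp] lemma idInv_left_assoc : type_of% (reassoc_of% @idInv_left) :=
  @(reassoc_of% @idInv_left)

@[simp] lemma left_idInv (A : SpanCat S) : left (𝟙 A) ≫ idInv A = 𝟙 _ :=
  Category.id_comp (𝟙 A.as)

@[simp] lemma left_idInv_assoc : type_of% (reassoc_of% @left_idInv) :=
  @(reassoc_of% @left_idInv)

@[simp] lemma id_right (A : SpanCat S) : right (𝟙 A) = left (𝟙 A) := (rfl)

/-- Whiskering of a morphism of spans by a span on the left. -/
noncomputable def whiskerL (f : A ⟶ B) {g h : B ⟶ C} (m : g ⟶ h) : f ≫ g ⟶ f ≫ h :=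
  mkHom (lift (p₁ f g) (p₂ f g ≫ top m) (by simp [condition])) (by simp) (by simp)

/-- Whiskering of a morphism of spans by a span on the right. -/
noncomputable def whiskerR {f g : A ⟶ B} (m : f ⟶ g) (h : B ⟶ C) : f ≫ h ⟶ g ≫ h :=
  mkHom (lift (p₁ f h ≫ top m) (p₂ f h) (by simp [condition])) (by simp) (by simp)

/-- The associator of the bicategory of spans. -/
noncomputable def assoc {D : SpanCat S} (f : A ⟶ B) (g : B ⟶ C) (h : C ⟶ D) :
    (f ≫ g) ≫ h ≅ f ≫ g ≫ h :=
  mkIso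
    (lift (p₁ (f ≫ g) h ≫ p₁ f g)
      (lift (p₁ (f ≫ g) h ≫ p₂ f g) (p₂ (f ≫ g) h) (by simpa using condition (f ≫ g) h))
      (by simp [condition]))
    (lift (lift (p₁ f (g ≫ h)) (p₂ f (g ≫ h) ≫ p₁ g h) (by simpa using condition f (g ≫ h)))
      (p₂ f (g ≫ h) ≫ p₂ g h) (by simp [condition]))
    (by simp) (by simp)
    (by apply apex_ext
        · apply apex_ext <;> simp
        · simp)
    (by apply apex_ext
        · simp
        · apply apex_ext <;> simp)

/-- The left unitor of the bicategory of spans. -/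
noncomputable def leftU (f : A ⟶ B) : 𝟙 A ≫ f ≅ f :=
  mkIso (p₂ (𝟙 A) f) (lift (left f ≫ idInv A) (𝟙 _) (by simp))
    (by simp [← condition]) (by simp)
    (by apply apex_ext
        · simp [← condition_assoc]
        · simp)
    (by simp)

/-- The right unitor of the bicategory of spans. -/
noncomputable def rightU (f : A ⟶ B) : f ≫ 𝟙 B ≅ f :=
  mkIso (p₁ f (𝟙 B)) (lift (𝟙 _) (right f ≫ idInv B) (by simp))
    (by simp) (by simp [condition])
    (by apply apex_ext
        · simp
        · simp [condition_assoc])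
    (by simp)

@[simp] lemma whiskerL_p₁ (f : A ⟶ B) {g h : B ⟶ C} (m : g ⟶ h) :
    top (whiskerL f m) ≫ p₁ f h = p₁ f g := by simp [whiskerL]

@[simp] lemma whiskerL_p₁_assoc : type_of% (reassoc_of% @whiskerL_p₁) :=
  @(reassoc_of% @whiskerL_p₁)

@[simp] lemma whiskerL_p₂ (f : A ⟶ B) {g h : B ⟶ C} (m : g ⟶ h) :
    top (whiskerL f m) ≫ p₂ f h = p₂ f g ≫ top m := by simp [whiskerL]

@[simp] lemma whiskerL_p₂_assoc : type_of% (reassoc_of% @whiskerL_p₂) :=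
  @(reassoc_of% @whiskerL_p₂)

@[simp] lemma whiskerR_p₁ {f g : A ⟶ B} (m : f ⟶ g) (h : B ⟶ C) :
    top (whiskerR m h) ≫ p₁ g h = p₁ f h ≫ top m := by simp [whiskerR]

@[simp] lemma whiskerR_p₁_assoc : type_of% (reassoc_of% @whiskerR_p₁) :=
  @(reassoc_of% @whiskerR_p₁)

@[simp] lemma whiskerR_p₂ {f g : A ⟶ B} (m : f ⟶ g) (h : B ⟶ C) :
    top (whiskerR m h) ≫ p₂ g h = p₂ f h := by simp [whiskerR]

@[simp] lemma whiskerR_p₂_assoc : type_of% (reassoc_of% @whiskerR_p₂) :=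
  @(reassoc_of% @whiskerR_p₂)

section
variable {D : SpanCat S} (f : A ⟶ B) (g : B ⟶ C) (h : C ⟶ D)

@[simp] lemma assoc_hom_p₁ :
    top (assoc f g h).hom ≫ p₁ f (g ≫ h) = p₁ (f ≫ g) h ≫ p₁ f g := by simp [assoc]

@[simp] lemma assoc_hom_p₁_assoc : type_of% (reassoc_of% @assoc_hom_p₁) :=
  @(reassoc_of% @assoc_hom_p₁)

@[simp] lemma assoc_hom_p₂_p₁ :
    top (assoc f g h).hom ≫ p₂ f (g ≫ h) ≫ p₁ g h = p₁ (f ≫ g) h ≫ p₂ f g := by simp [assoc]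

@[simp] lemma assoc_hom_p₂_p₁_assoc : type_of% (reassoc_of% @assoc_hom_p₂_p₁) :=
  @(reassoc_of% @assoc_hom_p₂_p₁)

@[simp] lemma assoc_hom_p₂_p₂ :
    top (assoc f g h).hom ≫ p₂ f (g ≫ h) ≫ p₂ g h = p₂ (f ≫ g) h := by simp [assoc]

@[simp] lemma assoc_hom_p₂_p₂_assoc : type_of% (reassoc_of% @assoc_hom_p₂_p₂) :=
  @(reassoc_of% @assoc_hom_p₂_p₂)

@[simp] lemma assoc_inv_p₁_p₁ :
    top (assoc f g h).inv ≫ p₁ (f ≫ g) h ≫ p₁ f g = p₁ f (g ≫ h) := by simp [assoc]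

@[simp] lemma assoc_inv_p₁_p₁_assoc : type_of% (reassoc_of% @assoc_inv_p₁_p₁) :=
  @(reassoc_of% @assoc_inv_p₁_p₁)

@[simp] lemma assoc_inv_p₁_p₂ :
    top (assoc f g h).inv ≫ p₁ (f ≫ g) h ≫ p₂ f g = p₂ f (g ≫ h) ≫ p₁ g h := by simp [assoc]

@[simp] lemma assoc_inv_p₁_p₂_assoc : type_of% (reassoc_of% @assoc_inv_p₁_p₂) :=
  @(reassoc_of% @assoc_inv_p₁_p₂)

@[simp] lemma assoc_inv_p₂ :
    top (assoc f g h).inv ≫ p₂ (f ≫ g) h = p₂ f (g ≫ h) ≫ p₂ g h := by simp [assoc]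

@[simp] lemma assoc_inv_p₂_assoc : type_of% (reassoc_of% @assoc_inv_p₂) :=
  @(reassoc_of% @assoc_inv_p₂)

@[simp] lemma leftU_hom : top (leftU f).hom = p₂ (𝟙 A) f := (rfl)

@[simp] lemma leftU_inv_p₁ :
    top (leftU f).inv ≫ p₁ (𝟙 A) f = left f ≫ idInv A := by simp [leftU]

@[simp] lemma leftU_inv_p₁_assoc : type_of% (reassoc_of% @leftU_inv_p₁) :=
  @(reassoc_of% @leftU_inv_p₁)

@[simp] lemma leftU_inv_p₂ :
    top (leftU f).inv ≫ p₂ (𝟙 A) f = 𝟙 _ := by simp [leftU]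

@[simp] lemma leftU_inv_p₂_assoc : type_of% (reassoc_of% @leftU_inv_p₂) :=
  @(reassoc_of% @leftU_inv_p₂)

@[simp] lemma rightU_hom : top (rightU f).hom = p₁ f (𝟙 B) := (rfl)

@[simp] lemma rightU_inv_p₁ :
    top (rightU f).inv ≫ p₁ f (𝟙 B) = 𝟙 _ := by simp [rightU]

@[simp] lemma rightU_inv_p₁_assoc : type_of% (reassoc_of% @rightU_inv_p₁) :=
  @(reassoc_of% @rightU_inv_p₁)

@[simp] lemma rightU_inv_p₂ :
    top (rightU f).inv ≫ p₂ f (𝟙 B) = right f ≫ idInv B := by simp [rightU]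

@[simp] lemma rightU_inv_p₂_assoc : type_of% (reassoc_of% @rightU_inv_p₂) :=
  @(reassoc_of% @rightU_inv_p₂)

lemma p₁_id (f : A ⟶ B) : p₁ (𝟙 A) f = p₂ (𝟙 A) f ≫ left f ≫ idInv A := by
  rw [← condition_assoc]; simp

lemma p₂_id (f : A ⟶ B) : p₂ f (𝟙 B) = p₁ f (𝟙 B) ≫ right f ≫ idInv B := by
  rw [condition_assoc]; simp

end

section laws
variable {D E : SpanCat S}

lemma whiskerL_id (f : A ⟶ B) (g : B ⟶ C) : whiskerL f (𝟙 g) = 𝟙 (f ≫ g) := by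
  ext; apply apex_ext <;> simp

lemma whiskerL_comp (f : A ⟶ B) {g h i : B ⟶ C} (m : g ⟶ h) (n : h ⟶ i) :
    whiskerL f (m ≫ n) = whiskerL f m ≫ whiskerL f n := by
  ext; apply apex_ext <;> simp

lemma id_whiskerL {f g : A ⟶ B} (m : f ⟶ g) :
    whiskerL (𝟙 A) m = (leftU f).hom ≫ m ≫ (leftU g).inv := by
  ext; apply apex_ext
  · simp [p₁_id]
  · simp

lemma comp_whiskerL (f : A ⟶ B) (g : B ⟶ C) {h i : C ⟶ D} (m : h ⟶ i) :
    whiskerL (f ≫ g) m = (assoc f g h).hom ≫ whiskerL f (whiskerL g m) ≫ (assoc f g i).inv := by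
  ext; apply apex_ext
  · apply apex_ext <;> simp
  · simp

lemma id_whiskerR (f : A ⟶ B) (g : B ⟶ C) : whiskerR (𝟙 f) g = 𝟙 (f ≫ g) := by
  ext; apply apex_ext <;> simp

lemma comp_whiskerR {f g h : A ⟶ B} (m : f ⟶ g) (n : g ⟶ h) (i : B ⟶ C) :
    whiskerR (m ≫ n) i = whiskerR m i ≫ whiskerR n i := by
  ext; apply apex_ext <;> simp

lemma whiskerR_id {f g : A ⟶ B} (m : f ⟶ g) :
    whiskerR m (𝟙 B) = (rightU f).hom ≫ m ≫ (rightU g).inv := by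
  ext; apply apex_ext
  · simp
  · simp [p₂_id]

lemma whiskerR_comp {f g : A ⟶ B} (m : f ⟶ g) (h : B ⟶ C) (i : C ⟶ D) :
    whiskerR m (h ≫ i) = (assoc f h i).inv ≫ whiskerR (whiskerR m h) i ≫ (assoc g h i).hom := by
  ext; apply apex_ext
  · simp
  · apply apex_ext <;> simp

lemma whisker_assoc' (f : A ⟶ B) {g h : B ⟶ C} (m : g ⟶ h) (i : C ⟶ D) :
    whiskerR (whiskerL f m) i =
      (assoc f g i).hom ≫ whiskerL f (whiskerR m i) ≫ (assoc f h i).inv := by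
  ext; apply apex_ext
  · apply apex_ext <;> simp
  · simp

lemma whisker_exchange' {f g : A ⟶ B} {h i : B ⟶ C} (m : f ⟶ g) (n : h ⟶ i) :
    whiskerL f n ≫ whiskerR m i = whiskerR m h ≫ whiskerL g n := by
  ext; apply apex_ext <;> simp

lemma pentagon' (f : A ⟶ B) (g : B ⟶ C) (h : C ⟶ D) (i : D ⟶ E) :
    whiskerR (assoc f g h).hom i ≫ (assoc f (g ≫ h) i).hom ≫ whiskerL f (assoc g h i).hom =
      (assoc (f ≫ g) h i).hom ≫ (assoc f g (h ≫ i)).hom := by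
  ext; apply apex_ext
  · simp
  · apply apex_ext
    · simp
    · apply apex_ext <;> simp

lemma triangle' (f : A ⟶ B) (g : B ⟶ C) :
    (assoc f (𝟙 B) g).hom ≫ whiskerL f (leftU g).hom = whiskerR (rightU f).hom g := by
  ext; apply apex_ext <;> simp

end laws

end

/-- The bicategory of spans in a category with pullbacks. -/
noncomputable instance : Bicategory (SpanCat S) where
  homCategory := homCat
  whiskerLeft f _ _ m := whiskerL f m
  whiskerRight m h := whiskerR m h
  associator f g h := assoc f g h
  leftUnitor f := leftU f
  rightUnitor f := rightU f
  whiskerLeft_id f g := whiskerL_id f g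
  whiskerLeft_comp f _ _ _ m n := whiskerL_comp f m n
  id_whiskerLeft m := id_whiskerL m
  comp_whiskerLeft f g _ _ m := comp_whiskerL f g m
  id_whiskerRight f g := id_whiskerR f g
  comp_whiskerRight m n h := comp_whiskerR m n h
  whiskerRight_id m := whiskerR_id m
  whiskerRight_comp m g h := whiskerR_comp m g h
  whisker_assoc f _ _ m h := whisker_assoc' f m h
  whisker_exchange m n := whisker_exchange' m n
  pentagon f g h i := pentagon' f g h i
  triangle f g := triangle' f g

end SpanCat

/-! ### Indexed categories -/

namespace IndexedCat

open Bicategory Bicategory.Opposite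

variable {B : Type u} [Bicategory.{w, v} B] (F : Bᵒᵖ ⥤ᵖ Cat.{v₁, u₁})

/-- The fibre of a `B`-indexed category over an object of `B`. -/
abbrev fib (A : B) : Type u₁ := F.obj (op A)

/-- The reindexing functor `f*` along a 1-morphism `f`. -/
abbrev pull {A A' : B} (f : A ⟶ A') : fib F A' ⥤ fib F A := (F.map f.op).toFunctor

/-- The natural transformation `f* ⟶ g*` given by a 2-morphism `f ⟶ g`. -/
abbrev pull₂ {A A' : B} {f g : A ⟶ A'} (m : f ⟶ g) : pull F f ⟶ pull F g :=
  (F.map₂ (op2 m)).toNatTrans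

/-- The coherence isomorphism `(𝟙 A)* X ≅ X`. -/
def pullId {A : B} (X : fib F A) : (pull F (𝟙 A)).obj X ≅ X :=
  (Cat.Hom.toNatIso (F.mapId (op A))).app X

/-- The coherence isomorphism `(f ≫ g)* Z ≅ f* (g* Z)`. -/
def pullComp {A A' A'' : B} (f : A ⟶ A') (g : A' ⟶ A'') (Z : fib F A'') :
    (pull F (f ≫ g)).obj Z ≅ (pull F f).obj ((pull F g).obj Z) :=
  (Cat.Hom.toNatIso (F.mapComp g.op f.op)).app Z

section
variable {A₁ A₂ A₃ A₄ : B}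

@[simp] lemma pull₂_id (f : A₁ ⟶ A₂) (Z : fib F A₂) : (pull₂ F (𝟙 f)).app Z = 𝟙 _ :=
  congrArg (fun t => (Cat.Hom₂.toNatTrans t).app Z) (F.map₂_id f.op)

lemma pull₂_comp {f g h : A₁ ⟶ A₂} (m : f ⟶ g) (n : g ⟶ h) (Z : fib F A₂) :
    (pull₂ F (m ≫ n)).app Z = (pull₂ F m).app Z ≫ (pull₂ F n).app Z :=
  congrArg (fun t => (Cat.Hom₂.toNatTrans t).app Z) (F.map₂_comp (op2 m) (op2 n))

lemma pullId_natural {X Y : fib F A₁} (a : X ⟶ Y) :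
    (pull F (𝟙 A₁)).map a ≫ (pullId F Y).hom = (pullId F X).hom ≫ a :=
  (F.mapId (op A₁)).hom.toNatTrans.naturality a

lemma pullId_natural_assoc : type_of% (reassoc_of% @pullId_natural) :=
  @(reassoc_of% @pullId_natural)

lemma pullComp_natural (f : A₁ ⟶ A₂) (g : A₂ ⟶ A₃) {X Y : fib F A₃} (a : X ⟶ Y) :
    (pull F (f ≫ g)).map a ≫ (pullComp F f g Y).hom =
      (pullComp F f g X).hom ≫ (pull F f).map ((pull F g).map a) :=
  (F.mapComp g.op f.op).hom.toNatTrans.naturality a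

lemma pullComp_natural_assoc : type_of% (reassoc_of% @pullComp_natural) :=
  @(reassoc_of% @pullComp_natural)

lemma pull₂_whiskerRight {f g : A₁ ⟶ A₂} (m : f ⟶ g) (h : A₂ ⟶ A₃) (Z : fib F A₃) :
    (pull₂ F (m ▷ h)).app Z ≫ (pullComp F g h Z).hom =
      (pullComp F f h Z).hom ≫ (pull₂ F m).app ((pull F h).obj Z) :=
  congrArg (fun t => (Cat.Hom₂.toNatTrans t).app Z)
    (F.toOplax.mapComp_naturality_right h.op (op2 m))

lemma pull₂_whiskerRight_assoc : type_of% (reassoc_of% @pull₂_whiskerRight) :=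
  @(reassoc_of% @pull₂_whiskerRight)

lemma pull₂_whiskerLeft (f : A₁ ⟶ A₂) {g h : A₂ ⟶ A₃} (m : g ⟶ h) (Z : fib F A₃) :
    (pull₂ F (f ◁ m)).app Z ≫ (pullComp F f h Z).hom =
      (pullComp F f g Z).hom ≫ (pull F f).map ((pull₂ F m).app Z) :=
  congrArg (fun t => (Cat.Hom₂.toNatTrans t).app Z)
    (F.toOplax.mapComp_naturality_left (op2 m) f.op)

lemma pull₂_whiskerLeft_assoc : type_of% (reassoc_of% @pull₂_whiskerLeft) :=
  @(reassoc_of% @pull₂_whiskerLeft)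

lemma pull₂_assoc (f : A₁ ⟶ A₂) (g : A₂ ⟶ A₃) (h : A₃ ⟶ A₄) (Z : fib F A₄) :
    (pull₂ F (α_ f g h).hom).app Z ≫ (pullComp F f (g ≫ h) Z).hom ≫
      (pull F f).map (pullComp F g h Z).hom =
    (pullComp F (f ≫ g) h Z).hom ≫ (pullComp F f g ((pull F h).obj Z)).hom := by
  have := congrArg (fun t => (Cat.Hom₂.toNatTrans t).app Z)
    (F.toOplax.map₂_associator h.op g.op f.op)
  have e : (pull₂ F (α_ f g h).hom).app Z ≫ (pull₂ F (α_ f g h).inv).app Z = 𝟙 _ := by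
    rw [← pull₂_comp, Iso.hom_inv_id, pull₂_id]
  have this' : (pull₂ F (α_ f g h).inv).app Z ≫ (pullComp F (f ≫ g) h Z).hom ≫
      (pullComp F f g ((pull F h).obj Z)).hom = (pullComp F f (g ≫ h) Z).hom ≫
      (pull F f).map (pullComp F g h Z).hom ≫ 𝟙 _ := this
  rw [Category.comp_id] at this'
  rw [← this', reassoc_of% e]

lemma pull₂_assoc_assoc : type_of% (reassoc_of% @pull₂_assoc) :=
  @(reassoc_of% @pull₂_assoc)

lemma pull₂_leftUnitor (f : A₁ ⟶ A₂) (Z : fib F A₂) :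
    (pull₂ F (λ_ f).hom).app Z =
      (pullComp F (𝟙 A₁) f Z).hom ≫ (pullId F ((pull F f).obj Z)).hom := by
  have := congrArg (fun t => (Cat.Hom₂.toNatTrans t).app Z)
    (F.toOplax.map₂_rightUnitor f.op)
  refine this.trans ?_
  exact congrArg _ (Category.comp_id _)

lemma pull₂_leftUnitor_assoc : type_of% (reassoc_of% @pull₂_leftUnitor) :=
  @(reassoc_of% @pull₂_leftUnitor)

lemma pull₂_rightUnitor (f : A₁ ⟶ A₂) (Z : fib F A₂) :
    (pull₂ F (ρ_ f).hom).app Z =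
      (pullComp F f (𝟙 A₂) Z).hom ≫ (pull F f).map (pullId F Z).hom := by
  have := congrArg (fun t => (Cat.Hom₂.toNatTrans t).app Z)
    (F.toOplax.map₂_leftUnitor f.op)
  refine this.trans ?_
  exact congrArg _ (Category.comp_id _)

lemma pull₂_rightUnitor_assoc : type_of% (reassoc_of% @pull₂_rightUnitor) :=
  @(reassoc_of% @pull₂_rightUnitor)

end

end IndexedCat

/-! ### Dependent optics -/

/-- Objects `(X, X')^A` of the category of dependent optics for two indexed categories. -/
structure Optic {B : Type u} [Bicategory.{w, v} B] (L : Pseudofunctor Bᵒᵖ Cat.{v₁, u₁})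
    (R : Pseudofunctor Bᵒᵖ Cat.{v₂, u₂}) where
  /-- The base object `A`. -/
  base : B
  /-- The object `X` of the first indexed category over `A`. -/
  fwd : IndexedCat.fib L base
  /-- The object `X'` of the second indexed category over `A`. -/
  bwd : IndexedCat.fib R base

namespace Optic

open Bicategory IndexedCat

variable {B : Type u} [Bicategory.{w, v} B] {L : Bᵒᵖ ⥤ᵖ Cat.{v₁, u₁}} {R : Bᵒᵖ ⥤ᵖ Cat.{v₂, u₂}}

/-- A pair `⟨l | r⟩` with representative `f`. -/
structure PreHom (X Y : Optic L R) where
  /-- The representative. -/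
  rep : X.base ⟶ Y.base
  /-- The forward part. -/
  l : X.fwd ⟶ (pull L rep).obj Y.fwd
  /-- The backward part. -/
  r : (pull R rep).obj Y.bwd ⟶ X.bwd

/-- The relation generating the equivalence relation of the coend over the representatives. -/
inductive Rel (X Y : Optic L R) : PreHom X Y → PreHom X Y → Prop
  | slide {f g : X.base ⟶ Y.base} (m : f ⟶ g) (l : X.fwd ⟶ (pull L f).obj Y.fwd)
      (r : (pull R g).obj Y.bwd ⟶ X.bwd) :
      Rel X Y ⟨g, l ≫ (pull₂ L m).app Y.fwd, r⟩ ⟨f, l, (pull₂ R m).app Y.bwd ≫ r⟩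

/-- Dependent optics: the coend over `f` of `L(X, f* Y) × R(f* Y', X')`, as a quotient. -/
def Hom (X Y : Optic L R) : Type (max v v₁ v₂) := Quot (Rel X Y)

/-- The class of a pair. -/
def cls {X Y : Optic L R} (f : X.base ⟶ Y.base) (l : X.fwd ⟶ (pull L f).obj Y.fwd)
    (r : (pull R f).obj Y.bwd ⟶ X.bwd) : Hom X Y := Quot.mk _ ⟨f, l, r⟩

lemma cls_slide {X Y : Optic L R} {f g : X.base ⟶ Y.base} (m : f ⟶ g)
    (l : X.fwd ⟶ (pull L f).obj Y.fwd) (r : (pull R g).obj Y.bwd ⟶ X.bwd) :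
    cls g (l ≫ (pull₂ L m).app Y.fwd) r = cls f l ((pull₂ R m).app Y.bwd ≫ r) :=
  Quot.sound (Rel.slide m l r)

lemma ind {X Y : Optic L R} {p : Hom X Y → Prop} (h : ∀ f l r, p (cls f l r)) (a : Hom X Y) : p a :=
  Quot.ind (fun ⟨f, l, r⟩ => h f l r) a

/-- The identity optic. -/
def id (X : Optic L R) : Hom X X := cls (𝟙 X.base) (pullId L X.fwd).inv (pullId R X.bwd).hom

lemma whiskerRight_inv {A₁ A₂ A₃ : B} {f g : A₁ ⟶ A₂} (m : f ⟶ g) (h : A₂ ⟶ A₃) (Z : fib L A₃) :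
    (pull₂ L m).app ((pull L h).obj Z) ≫ (pullComp L g h Z).inv =
      (pullComp L f h Z).inv ≫ (pull₂ L (m ▷ h)).app Z := by
  rw [Iso.comp_inv_eq, Category.assoc, pull₂_whiskerRight, Iso.inv_hom_id_assoc]

lemma whiskerLeft_inv {A₁ A₂ A₃ : B} (f : A₁ ⟶ A₂) {g h : A₂ ⟶ A₃} (m : g ⟶ h) (Z : fib L A₃) :
    (pull L f).map ((pull₂ L m).app Z) ≫ (pullComp L f h Z).inv =
      (pullComp L f g Z).inv ≫ (pull₂ L (f ◁ m)).app Z := by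
  rw [Iso.comp_inv_eq, Category.assoc, pull₂_whiskerLeft, Iso.inv_hom_id_assoc]

/-- Composition of optics. -/
def comp {X Y Z : Optic L R} (a : Hom X Y) (b : Hom Y Z) : Hom X Z :=
  Quot.lift₂ (fun a b => cls (a.rep ≫ b.rep)
      (a.l ≫ (pull L a.rep).map b.l ≫ (pullComp L a.rep b.rep Z.fwd).inv)
      ((pullComp R a.rep b.rep Z.bwd).hom ≫ (pull R a.rep).map b.r ≫ a.r))
    (by
      rintro ⟨k, l', r'⟩ _ _ ⟨m, l, r⟩
      have h := cls_slide (X := X) (Y := Z) (k ◁ m)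
        (l' ≫ (pull L k).map l ≫ (pullComp L k _ Z.fwd).inv)
        ((pullComp R k _ Z.bwd).hom ≫ (pull R k).map r ≫ r')
      simpa [whiskerLeft_inv, pull₂_whiskerLeft_assoc] using h)
    (by
      rintro _ _ ⟨k, l', r'⟩ ⟨m, l, r⟩
      have h := cls_slide (X := X) (Y := Z) (m ▷ k)
        (l ≫ (pull L _).map l' ≫ (pullComp L _ k Z.fwd).inv)
        ((pullComp R _ k Z.bwd).hom ≫ (pull R _).map r' ≫ r)
      have e : (pull₂ L m).app Y.fwd ≫ (pull L _).map l' ≫ (pullComp L _ k Z.fwd).inv =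
          (pull L _).map l' ≫ (pullComp L _ k Z.fwd).inv ≫ (pull₂ L (m ▷ k)).app Z.fwd := by
        rw [← NatTrans.naturality_assoc, whiskerRight_inv]
      simpa [e, pull₂_whiskerRight_assoc] using h) a b

lemma comp_cls {X Y Z : Optic L R} (f : X.base ⟶ Y.base) (l : X.fwd ⟶ (pull L f).obj Y.fwd)
    (r : (pull R f).obj Y.bwd ⟶ X.bwd) (g : Y.base ⟶ Z.base)
    (l' : Y.fwd ⟶ (pull L g).obj Z.fwd) (r' : (pull R g).obj Z.bwd ⟶ Y.bwd) :
    comp (cls f l r) (cls g l' r') =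
      cls (f ≫ g) (l ≫ (pull L f).map l' ≫ (pullComp L f g Z.fwd).inv)
        ((pullComp R f g Z.bwd).hom ≫ (pull R f).map r' ≫ r) := rfl

/-- Two pairs are identified if a 2-morphism between their representatives matches them. -/
lemma cls_eq {X Y : Optic L R} {f g : X.base ⟶ Y.base} (m : f ⟶ g)
    {l : X.fwd ⟶ (pull L f).obj Y.fwd} {l' : X.fwd ⟶ (pull L g).obj Y.fwd}
    {r : (pull R f).obj Y.bwd ⟶ X.bwd} {r' : (pull R g).obj Y.bwd ⟶ X.bwd}
    (hl : l ≫ (pull₂ L m).app Y.fwd = l') (hr : r = (pull₂ R m).app Y.bwd ≫ r') :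
    cls f l r = cls g l' r' := by
  subst hl hr
  exact (cls_slide m l r').symm

/-- The category of dependent optics. -/
instance : Category (Optic L R) where
  Hom := Hom
  id := id
  comp := comp
  id_comp := by
    intro X Y a
    induction a using ind with | h f l r
    refine cls_eq (λ_ f).hom ?_ ?_
    · rw [pull₂_leftUnitor]
      simp [pullId_natural]
    · rw [pull₂_leftUnitor]
      simp [pullId_natural]
  comp_id := by
    intro X Y a
    induction a using ind with | h f l r
    refine cls_eq (ρ_ f).hom ?_ ?_
    · rw [pull₂_rightUnitor]
      simp [← Functor.map_comp]
    · rw [pull₂_rightUnitor]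
      simp
  assoc := by
    intro X Y Z W a b c
    induction a using ind with | h f l r
    induction b using ind with | h f' l' r'
    induction c using ind with | h f'' l'' r''
    simp only [comp_cls]
    refine cls_eq (α_ f f' f'').hom ?_ ?_
    · have e : (pullComp L f f' ((pull L f'').obj W.fwd)).inv ≫
          (pullComp L (f ≫ f') f'' W.fwd).inv ≫ (pull₂ L (α_ f f' f'').hom).app W.fwd =
          (pull L f).map (pullComp L f' f'' W.fwd).inv ≫ (pullComp L f (f' ≫ f'') W.fwd).inv := by
        rw [Iso.inv_comp_eq, Iso.inv_comp_eq, ← pull₂_assoc_assoc, ← Functor.map_comp_assoc]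
        simp
      have e' : (pullComp L f f' Z.fwd).inv ≫ (pull L (f ≫ f')).map l'' =
          (pull L f).map ((pull L f').map l'') ≫ (pullComp L f f' _).inv := by
        rw [Iso.inv_comp_eq, ← pullComp_natural_assoc, Iso.hom_inv_id, Category.comp_id]
      simp [e, reassoc_of% e']
    · simp [pullComp_natural_assoc, pull₂_assoc_assoc]

end Optic

/-! ### Building indexed categories -/

set_option linter.checkUnivs false in
open Bicategory in
/-- Componentwise data for a `B`-indexed category. -/
structure IndexedCatCore (B : Type u) [Bicategory.{w, v} B] where
  /-- The fibres. -/
  E : B → Type u₁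
  /-- The category structure on the fibres. -/
  [cat : ∀ A, Category.{v₁} (E A)]
  /-- Reindexing. -/
  pull {A A' : B} (f : A ⟶ A') : E A' ⥤ E A
  /-- Reindexing on 2-morphisms. -/
  pull₂ {A A' : B} {f g : A ⟶ A'} (m : f ⟶ g) : pull f ⟶ pull g
  /-- Comparison for identities. -/
  unit (A : B) : pull (𝟙 A) ≅ 𝟭 (E A)
  /-- Comparison for composites. -/
  mult {A A' A'' : B} (f : A ⟶ A') (g : A' ⟶ A'') : pull (f ≫ g) ≅ pull g ⋙ pull f
  pull₂_id {A A' : B} (f : A ⟶ A') (Z : E A') : (pull₂ (𝟙 f)).app Z = 𝟙 _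
  pull₂_comp {A A' : B} {f g h : A ⟶ A'} (m : f ⟶ g) (n : g ⟶ h) (Z : E A') :
    (pull₂ (m ≫ n)).app Z = (pull₂ m).app Z ≫ (pull₂ n).app Z
  whiskerRight {A A' A'' : B} {f g : A ⟶ A'} (m : f ⟶ g) (h : A' ⟶ A'') (Z : E A'') :
    (pull₂ (m ▷ h)).app Z ≫ (mult g h).hom.app Z =
      (mult f h).hom.app Z ≫ (pull₂ m).app ((pull h).obj Z)
  whiskerLeft {A A' A'' : B} (f : A ⟶ A') {g h : A' ⟶ A''} (m : g ⟶ h) (Z : E A'') :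
    (pull₂ (f ◁ m)).app Z ≫ (mult f h).hom.app Z =
      (mult f g).hom.app Z ≫ (pull f).map ((pull₂ m).app Z)
  assoc {A₁ A₂ A₃ A₄ : B} (f : A₁ ⟶ A₂) (g : A₂ ⟶ A₃) (h : A₃ ⟶ A₄) (Z : E A₄) :
    (pull₂ (α_ f g h).hom).app Z ≫ (mult f (g ≫ h)).hom.app Z ≫
      (pull f).map ((mult g h).hom.app Z) =
    (mult (f ≫ g) h).hom.app Z ≫ (mult f g).hom.app ((pull h).obj Z)
  leftUnitor {A A' : B} (f : A ⟶ A') (Z : E A') :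
    (pull₂ (λ_ f).hom).app Z = (mult (𝟙 A) f).hom.app Z ≫ (unit A).hom.app ((pull f).obj Z)
  rightUnitor {A A' : B} (f : A ⟶ A') (Z : E A') :
    (pull₂ (ρ_ f).hom).app Z = (mult f (𝟙 A')).hom.app Z ≫ (pull f).map ((unit A').hom.app Z)

namespace IndexedCatCore

open Bicategory Bicategory.Opposite

attribute [instance] cat

variable {B : Type u} [Bicategory.{w, v} B] (D : IndexedCatCore.{w, v, v₁, u, u₁} B)

lemma assoc_inv {A₁ A₂ A₃ A₄ : B} (f : A₁ ⟶ A₂) (g : A₂ ⟶ A₃) (h : A₃ ⟶ A₄) (Z : D.E A₄) :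
    (D.pull₂ (α_ f g h).inv).app Z ≫ (D.mult (f ≫ g) h).hom.app Z ≫
      (D.mult f g).hom.app ((D.pull h).obj Z) =
    (D.mult f (g ≫ h)).hom.app Z ≫ (D.pull f).map ((D.mult g h).hom.app Z) := by
  have e : (D.pull₂ (α_ f g h).inv).app Z ≫ (D.pull₂ (α_ f g h).hom).app Z = 𝟙 _ := by
    rw [← D.pull₂_comp, Iso.inv_hom_id, D.pull₂_id]
  rw [← D.assoc, reassoc_of% e]

/-- The oplax functor underlying the indexed category. -/
def toOplax : OplaxFunctor Bᵒᵖ Cat.{v₁, u₁} where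
  obj A := Cat.of (D.E A.unop)
  map f := (D.pull f.unop).toCatHom
  map₂ m := (D.pull₂ m.unop2).toCatHom₂
  map₂_id f := by ext Z; exact D.pull₂_id _ _
  map₂_comp m n := by ext Z; exact D.pull₂_comp _ _ _
  mapId A := (D.unit A.unop).hom.toCatHom₂
  mapComp f g := (D.mult g.unop f.unop).hom.toCatHom₂
  mapComp_naturality_left m g := by ext Z; exact D.whiskerLeft _ _ _
  mapComp_naturality_right f _ _ m := by ext Z; exact D.whiskerRight _ _ _
  map₂_associator f g h := by
    ext Z
    exact (D.assoc_inv _ _ _ Z).trans (congrArg _ (Category.comp_id _).symm)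
  map₂_leftUnitor f := by
    ext Z
    refine (D.rightUnitor _ _).trans (congrArg _ (Category.comp_id _).symm)
  map₂_rightUnitor f := by
    ext Z
    refine (D.leftUnitor _ _).trans (congrArg _ (Category.comp_id _).symm)

/-- The indexed category with the given components. -/
def toIndexedCat : Pseudofunctor Bᵒᵖ Cat.{v₁, u₁} :=
  Pseudofunctor.mkOfOplax D.toOplax
    { mapIdIso := fun A => Cat.Hom.isoMk (D.unit A.unop)
      mapCompIso := fun f g => Cat.Hom.isoMk (D.mult g.unop f.unop)
      mapIdIso_hom := rfl
      mapCompIso_hom := fun _ _ => rfl }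

end IndexedCatCore

/-! ### Slice categories, indexed by spans -/

namespace OverSpan

open SpanCat Bicategory

variable {S : Type u} [Category.{v} S] [HasPullbacks S] {A₁ A₂ A₃ A₄ : SpanCat S}

/-- Reindexing of slices along a span: pull back along the right leg, then push forward along the
left leg. -/
noncomputable def reindex (f : A₁ ⟶ A₂) : Over A₂.as ⥤ Over A₁.as :=
  Over.pullback (right f) ⋙ Over.map (left f)

/-- The first projection of the pullback underlying `reindex`. -/
noncomputable def pr (f : A₁ ⟶ A₂) (Z : Over A₂.as) : ((reindex f).obj Z).left ⟶ Z.left :=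
  pullback.fst Z.hom (right f)

/-- The second projection of the pullback underlying `reindex`. -/
noncomputable def ap (f : A₁ ⟶ A₂) (Z : Over A₂.as) : ((reindex f).obj Z).left ⟶ apex f :=
  pullback.snd Z.hom (right f)

lemma condition (f : A₁ ⟶ A₂) (Z : Over A₂.as) :
    pr f Z ≫ Z.hom = ap f Z ≫ right f := pullback.condition

lemma condition_assoc : type_of% (reassoc_of% @condition) :=
  @(reassoc_of% @condition)

@[simp] lemma reindex_hom (f : A₁ ⟶ A₂) (Z : Over A₂.as) :
    ((reindex f).obj Z).hom = ap f Z ≫ left f := (rfl)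

@[simp] lemma reindex_hom_assoc : type_of% (reassoc_of% @reindex_hom) :=
  @(reassoc_of% @reindex_hom)

@[simp] lemma map_pr (f : A₁ ⟶ A₂) {Y Z : Over A₂.as} (a : Y ⟶ Z) :
    ((reindex f).map a).left ≫ pr f Z = pr f Y ≫ a.left := pullback.lift_fst _ _ _

@[simp] lemma map_pr_assoc : type_of% (reassoc_of% @map_pr) :=
  @(reassoc_of% @map_pr)

@[simp] lemma map_ap (f : A₁ ⟶ A₂) {Y Z : Over A₂.as} (a : Y ⟶ Z) :
    ((reindex f).map a).left ≫ ap f Z = ap f Y := pullback.lift_snd _ _ _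

@[simp] lemma map_ap_assoc : type_of% (reassoc_of% @map_ap) :=
  @(reassoc_of% @map_ap)

/-- Maps into the pullback underlying `reindex`. -/
noncomputable def lift {f : A₁ ⟶ A₂} {Z : Over A₂.as} {X : S} (a : X ⟶ Z.left) (b : X ⟶ apex f)
    (h : a ≫ Z.hom = b ≫ right f) : X ⟶ ((reindex f).obj Z).left := pullback.lift a b h

@[simp] lemma lift_pr {f : A₁ ⟶ A₂} {Z : Over A₂.as} {X : S} (a : X ⟶ Z.left)
    (b : X ⟶ apex f) (h : a ≫ Z.hom = b ≫ right f) : lift a b h ≫ pr f Z = a :=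
  pullback.lift_fst _ _ _

@[simp] lemma lift_pr_assoc : type_of% (reassoc_of% @lift_pr) :=
  @(reassoc_of% @lift_pr)

@[simp] lemma lift_ap {f : A₁ ⟶ A₂} {Z : Over A₂.as} {X : S} (a : X ⟶ Z.left)
    (b : X ⟶ apex f) (h : a ≫ Z.hom = b ≫ right f) : lift a b h ≫ ap f Z = b :=
  pullback.lift_snd _ _ _

@[simp] lemma lift_ap_assoc : type_of% (reassoc_of% @lift_ap) :=
  @(reassoc_of% @lift_ap)

lemma ext {f : A₁ ⟶ A₂} {Z : Over A₂.as} {X : S} {a b : X ⟶ ((reindex f).obj Z).left}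
    (h₁ : a ≫ pr f Z = b ≫ pr f Z) (h₂ : a ≫ ap f Z = b ≫ ap f Z) : a = b :=
  pullback.hom_ext h₁ h₂

/-- Reindexing on morphisms of spans. -/
noncomputable def reindex₂ {f g : A₁ ⟶ A₂} (m : f ⟶ g) : reindex f ⟶ reindex g where
  app Z := Over.homMk (lift (pr f Z) (ap f Z ≫ top m) (by simp [condition])) (by simp)
  naturality Y Z a := by ext; apply ext <;> simp

@[simp] lemma reindex₂_pr {f g : A₁ ⟶ A₂} (m : f ⟶ g) (Z : Over A₂.as) :
    ((reindex₂ m).app Z).left ≫ pr g Z = pr f Z := lift_pr _ _ _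

@[simp] lemma reindex₂_pr_assoc : type_of% (reassoc_of% @reindex₂_pr) :=
  @(reassoc_of% @reindex₂_pr)

@[simp] lemma reindex₂_ap {f g : A₁ ⟶ A₂} (m : f ⟶ g) (Z : Over A₂.as) :
    ((reindex₂ m).app Z).left ≫ ap g Z = ap f Z ≫ top m := lift_ap _ _ _

@[simp] lemma reindex₂_ap_assoc : type_of% (reassoc_of% @reindex₂_ap) :=
  @(reassoc_of% @reindex₂_ap)

/-- Reindexing along the identity span. -/
noncomputable def unit (A : SpanCat S) : reindex (𝟙 A) ≅ 𝟭 (Over A.as) :=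
  NatIso.ofComponents (fun Z => Over.isoMk
    { hom := pr (𝟙 A) Z
      inv := lift (f := 𝟙 A) (𝟙 Z.left) (Z.hom ≫ idInv A) (by simp)
      hom_inv_id := by apply ext <;> simp [condition_assoc]
      inv_hom_id := by simp } (by simp [condition])) (fun a => by ext; simp)

@[simp] lemma unit_left (A : SpanCat S) (Z : Over A.as) :
    ((unit A).hom.app Z).left = pr (𝟙 A) Z := (rfl)

/-- Reindexing along a composite span. -/
noncomputable def mult (f : A₁ ⟶ A₂) (g : A₂ ⟶ A₃) :
    reindex (f ≫ g) ≅ reindex g ⋙ reindex f :=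
  NatIso.ofComponents (fun Z => Over.isoMk
    { hom := lift (f := f) (Z := (reindex g).obj Z)
        (lift (pr (f ≫ g) Z) (ap (f ≫ g) Z ≫ p₂ f g) (by simp [condition]))
        (ap (f ≫ g) Z ≫ p₁ f g) (by simp [SpanCat.condition])
      inv := lift (pr f ((reindex g).obj Z) ≫ pr g Z)
        (SpanCat.lift (ap f ((reindex g).obj Z)) (pr f ((reindex g).obj Z) ≫ ap g Z)
          (by rw [← condition]; simp)) (by simp [condition])
      hom_inv_id := by
        apply ext
        · simp
        · apply apex_ext <;> simp
      inv_hom_id := by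
        apply ext
        · apply ext <;> simp
        · simp } (by simp))
    (fun a => by
      ext; apply ext
      · apply ext <;> simp
      · simp)

section
variable (f : A₁ ⟶ A₂) (g : A₂ ⟶ A₃) (Z : Over A₃.as)

@[simp] lemma mult_pr_pr :
    ((mult f g).hom.app Z).left ≫ pr f ((reindex g).obj Z) ≫ pr g Z = pr (f ≫ g) Z := by
  simp [mult]

@[simp] lemma mult_pr_pr_assoc : type_of% (reassoc_of% @mult_pr_pr) :=
  @(reassoc_of% @mult_pr_pr)

@[simp] lemma mult_pr_ap :
    ((mult f g).hom.app Z).left ≫ pr f ((reindex g).obj Z) ≫ ap g Z =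
      ap (f ≫ g) Z ≫ p₂ f g := by
  simp [mult]

@[simp] lemma mult_pr_ap_assoc : type_of% (reassoc_of% @mult_pr_ap) :=
  @(reassoc_of% @mult_pr_ap)

@[simp] lemma mult_ap :
    ((mult f g).hom.app Z).left ≫ ap f ((reindex g).obj Z) = ap (f ≫ g) Z ≫ p₁ f g := by
  simp [mult]

@[simp] lemma mult_ap_assoc : type_of% (reassoc_of% @mult_ap) :=
  @(reassoc_of% @mult_ap)

end

lemma whiskerRight {f g : A₁ ⟶ A₂} (m : f ⟶ g) (h : A₂ ⟶ A₃) (Z : Over A₃.as) :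
    (reindex₂ (whiskerR m h)).app Z ≫ (mult g h).hom.app Z =
      (mult f h).hom.app Z ≫ (reindex₂ m).app ((reindex h).obj Z) := by
  ext; apply ext
  · apply ext <;> simp
  · simp

lemma whiskerLeft (f : A₁ ⟶ A₂) {g h : A₂ ⟶ A₃} (m : g ⟶ h) (Z : Over A₃.as) :
    (reindex₂ (whiskerL f m)).app Z ≫ (mult f h).hom.app Z =
      (mult f g).hom.app Z ≫ (reindex f).map ((reindex₂ m).app Z) := by
  ext; apply ext
  · apply ext <;> simp
  · simp

lemma assoc (f : A₁ ⟶ A₂) (g : A₂ ⟶ A₃) (h : A₃ ⟶ A₄) (Z : Over A₄.as) :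
    (reindex₂ (SpanCat.assoc f g h).hom).app Z ≫ (mult f (g ≫ h)).hom.app Z ≫
      (reindex f).map ((mult g h).hom.app Z) =
    (mult (f ≫ g) h).hom.app Z ≫ (mult f g).hom.app ((reindex h).obj Z) := by
  ext; apply ext
  · apply ext
    · apply ext <;> simp
    · simp
  · simp

lemma leftUnitor (f : A₁ ⟶ A₂) (Z : Over A₂.as) :
    (reindex₂ (leftU f).hom).app Z =
      (mult (𝟙 A₁) f).hom.app Z ≫ (unit A₁).hom.app ((reindex f).obj Z) := by
  ext; apply ext <;> simp

lemma rightUnitor (f : A₁ ⟶ A₂) (Z : Over A₂.as) :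
    (reindex₂ (rightU f).hom).app Z =
      (mult f (𝟙 A₂)).hom.app Z ≫ (reindex f).map ((unit A₂).hom.app Z) := by
  ext; apply ext <;> simp

/-- The `Span S`-indexed category of slices. -/
noncomputable def core (S : Type u) [Category.{v} S] [HasPullbacks S] :
    IndexedCatCore (SpanCat S) where
  E A := Over A.as
  pull f := reindex f
  pull₂ m := reindex₂ m
  unit A := unit A
  mult f g := mult f g
  pull₂_id f Z := by ext; apply ext <;> simp
  pull₂_comp m n Z := by ext; apply ext <;> simp
  whiskerRight m h Z := whiskerRight m h Z
  whiskerLeft f _ _ m Z := whiskerLeft f m Z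
  assoc f g h Z := assoc f g h Z
  leftUnitor f Z := leftUnitor f Z
  rightUnitor f Z := rightUnitor f Z

end OverSpan

/-! ### Comodules over commutative comonoids -/

open MonoidalCategory in
/-- Tensoring with any object preserves equalizers of coreflexive pairs. (As `C` is symmetric, it
is enough to consider tensoring on the left.) -/
class TensorPreservesCoreflexiveEqualizers (C : Type u) [Category.{v} C] [MonoidalCategory C] :
    Prop where
  preserves (X : C) {Y Z : C} (f g : Y ⟶ Z) [IsCoreflexivePair f g] :
    PreservesLimit (parallelPair f g) (tensorLeft X)

namespace ComodAux

open MonoidalCategory ComonObj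

variable {C : Type u} [Category.{v} C] [MonoidalCategory C] [SymmetricCategory C]
  {A B M N : CommComon C}

/-- The morphism of `C` underlying a morphism of commutative comonoids. -/
def und (p : M ⟶ B) : M.X ⟶ B.X := p.hom.hom

@[simp] lemma und_id (A : CommComon C) : und (𝟙 A) = 𝟙 A.X := (rfl)

@[simp] lemma und_comp (p : M ⟶ N) (q : N ⟶ B) :
    und (p ≫ q) = und p ≫ und q := (rfl)

@[simp] lemma und_comp_assoc : type_of% (reassoc_of% @und_comp) :=
  @(reassoc_of% @und_comp)

@[simp] lemma und_counit (p : M ⟶ B) : und p ≫ ε[B.X] = ε[M.X] :=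
  IsComonHom.hom_counit p.hom.hom

@[simp] lemma und_counit_assoc : type_of% (reassoc_of% @und_counit) :=
  @(reassoc_of% @und_counit)

lemma und_comul (p : M ⟶ B) :
    und p ≫ Δ[B.X] = Δ[M.X] ≫ und p ▷ M.X ≫ B.X ◁ und p :=
  (IsComonHom.hom_comul p.hom.hom).trans
    (congrArg _ (MonoidalCategory.tensorHom_def (und p) (und p)))

lemma und_comul_assoc : type_of% (reassoc_of% @und_comul) :=
  @(reassoc_of% @und_comul)

/-- The map `X ⊗ A ⟶ (X ⊗ A) ⊗ A` given by comultiplication. -/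
def dup (A : CommComon C) (X : C) : X ⊗ A.X ⟶ (X ⊗ A.X) ⊗ A.X :=
  X ◁ Δ[A.X] ≫ (α_ X A.X A.X).inv

/-- The map `X ⊗ A ⟶ X` given by the counit. -/
def del (A : CommComon C) (X : C) : X ⊗ A.X ⟶ X := X ◁ ε[A.X] ≫ (ρ_ X).hom

lemma dup_natural {X Y : C} (φ : X ⟶ Y) :
    φ ▷ A.X ≫ dup A Y = dup A X ≫ φ ▷ A.X ▷ A.X := by
  simp [dup, ← whisker_exchange_assoc]

lemma dup_natural_assoc : type_of% (reassoc_of% @dup_natural) :=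
  @(reassoc_of% @dup_natural)

lemma del_natural {X Y : C} (φ : X ⟶ Y) :
    φ ▷ A.X ≫ del A Y = del A X ≫ φ := by
  simp [del, ← whisker_exchange_assoc]

lemma del_natural_assoc : type_of% (reassoc_of% @del_natural) :=
  @(reassoc_of% @del_natural)

@[simp] lemma dup_del (X : C) : dup A X ≫ del A (X ⊗ A.X) = 𝟙 _ := by
  have : dup A X ≫ del A (X ⊗ A.X) = X ◁ (Δ[A.X] ≫ A.X ◁ ε[A.X]) ≫ X ◁ (ρ_ A.X).hom := by
    simp only [dup, del, Category.assoc, whiskerLeft_comp]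
    monoidal
  rw [this, comul_counit, ← whiskerLeft_comp, Iso.inv_hom_id, whiskerLeft_id]

@[simp] lemma dup_del_assoc : type_of% (reassoc_of% @dup_del) :=
  @(reassoc_of% @dup_del)

@[simp] lemma dup_del_right (X : C) : dup A X ≫ del A X ▷ A.X = 𝟙 _ := by
  have : dup A X ≫ del A X ▷ A.X = X ◁ (Δ[A.X] ≫ ε[A.X] ▷ A.X) ≫ X ◁ (λ_ A.X).hom := by
    simp only [dup, del, Category.assoc, whiskerLeft_comp]
    monoidal
  rw [this, counit_comul, ← whiskerLeft_comp, Iso.inv_hom_id, whiskerLeft_id]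

@[simp] lemma dup_del_right_assoc : type_of% (reassoc_of% @dup_del_right) :=
  @(reassoc_of% @dup_del_right)

lemma dup_dup (X : C) :
    dup A X ≫ dup A (X ⊗ A.X) = dup A X ≫ dup A X ▷ A.X := by
  have h₁ : dup A X ≫ dup A (X ⊗ A.X) = X ◁ (Δ[A.X] ≫ A.X ◁ Δ[A.X]) ≫
      (α_ X A.X (A.X ⊗ A.X)).inv ≫ (α_ (X ⊗ A.X) A.X A.X).inv := by
    simp only [dup, whiskerLeft_comp, Category.assoc]
    monoidal
  have h₂ : dup A X ≫ dup A X ▷ A.X = X ◁ (Δ[A.X] ≫ Δ[A.X] ▷ A.X ≫ (α_ A.X A.X A.X).hom) ≫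
      (α_ X A.X (A.X ⊗ A.X)).inv ≫ (α_ (X ⊗ A.X) A.X A.X).inv := by
    simp only [dup, whiskerLeft_comp, Category.assoc]
    monoidal
  rw [h₁, h₂, comul_assoc]

lemma dup_dup_assoc : type_of% (reassoc_of% @dup_dup) :=
  @(reassoc_of% @dup_dup)

lemma dup_hom (p : M ⟶ B) (X : C) :
    dup M X ≫ (X ◁ und p) ▷ M.X ≫ (X ⊗ B.X) ◁ und p = X ◁ und p ≫ dup B X := by
  rw [dup, dup, ← whiskerLeft_comp_assoc, und_comul]
  simp only [whiskerLeft_comp, Category.assoc]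
  monoidal

lemma dup_hom_assoc : type_of% (reassoc_of% @dup_hom) :=
  @(reassoc_of% @dup_hom)

@[simp] lemma del_hom (p : M ⟶ B) (X : C) :
    X ◁ und p ≫ del B X = del M X := by
  rw [del, ← whiskerLeft_comp_assoc, und_counit]; rfl

@[simp] lemma del_hom_assoc : type_of% (reassoc_of% @del_hom) :=
  @(reassoc_of% @del_hom)

section
variable [HasCoreflexiveEqualizers C] [TensorPreservesCoreflexiveEqualizers C]
  {Y Z : C} (f g : Y ⟶ Z) [IsCoreflexivePair f g]

/-- Tensoring an equalizer of a coreflexive pair on the left. -/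
lemma isLimitLeft (X : C) : Nonempty (IsLimit (Fork.ofι (X ◁ equalizer.ι f g)
    (by rw [← whiskerLeft_comp, equalizer.condition, whiskerLeft_comp]) :
      Fork (X ◁ f) (X ◁ g))) := by
  have := TensorPreservesCoreflexiveEqualizers.preserves X f g
  exact ⟨isLimitOfHasEqualizerOfPreservesLimit (tensorLeft X) f g⟩

/-- Tensoring an equalizer of a coreflexive pair on the right. -/
lemma isLimitRight (X : C) : Nonempty (IsLimit (Fork.ofι (equalizer.ι f g ▷ X)
    (by rw [← comp_whiskerRight, equalizer.condition, comp_whiskerRight]) :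
      Fork (f ▷ X) (g ▷ X))) := by
  have := TensorPreservesCoreflexiveEqualizers.preserves X f g
  have : PreservesLimit (parallelPair f g) (tensorRight X) :=
    preservesLimit_of_natIso _ (BraidedCategory.tensorLeftIsoTensorRight X)
  exact ⟨isLimitOfHasEqualizerOfPreservesLimit (tensorRight X) f g⟩

lemma mono_left (X : C) : Mono (X ◁ equalizer.ι f g) :=
  mono_of_isLimit_fork (isLimitLeft f g X).some

lemma mono_right (X : C) : Mono (equalizer.ι f g ▷ X) :=
  mono_of_isLimit_fork (isLimitRight f g X).some

lemma exists_left {X T : C} (j : T ⟶ X ⊗ Y) (h : j ≫ X ◁ f = j ≫ X ◁ g) :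
    ∃ k : T ⟶ X ⊗ equalizer f g, k ≫ X ◁ equalizer.ι f g = j :=
  ⟨_, Fork.IsLimit.lift_ι' (isLimitLeft f g X).some j h⟩

lemma exists_right {X T : C} (j : T ⟶ Y ⊗ X) (h : j ≫ f ▷ X = j ≫ g ▷ X) :
    ∃ k : T ⟶ equalizer f g ⊗ X, k ≫ equalizer.ι f g ▷ X = j :=
  ⟨_, Fork.IsLimit.lift_ι' (isLimitRight f g X).some j h⟩

end

end ComodAux

open MonoidalCategory ComonObj in
/-- Right comodules over a commutative comonoid `A`. As `A` is commutative and `C` is symmetric,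
left and right comodules are the same. -/
structure Comod {C : Type u} [Category.{v} C] [MonoidalCategory C] [SymmetricCategory C]
    (A : CommComon C) where
  /-- The underlying object. -/
  X : C
  /-- The coaction. -/
  coact : X ⟶ X ⊗ A.X
  coact_counit : coact ≫ X ◁ ε[A.X] = (ρ_ X).inv
  coact_comul : coact ≫ X ◁ Δ[A.X] = coact ≫ coact ▷ A.X ≫ (α_ X A.X A.X).hom

namespace Comod

open MonoidalCategory ComonObj ComodAux

variable {C : Type u} [Category.{v} C] [MonoidalCategory C] [SymmetricCategory C]

/-- Morphisms of comodules. -/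
@[ext] structure Hom {A : CommComon C} (X Y : Comod A) where
  /-- The underlying morphism. -/
  hom : X.X ⟶ Y.X
  comm : hom ≫ Y.coact = X.coact ≫ hom ▷ A.X

lemma Hom.comm_assoc : type_of% (reassoc_of% @Hom.comm) := @(reassoc_of% @Hom.comm)

/-- The category of comodules. -/
@[simps]
instance (A : CommComon C) : Category (Comod A) where
  Hom X Y := Hom X Y
  id X := ⟨𝟙 _, by simp⟩
  comp f g := ⟨f.hom ≫ g.hom, by simp [Hom.comm, Hom.comm_assoc]⟩

@[ext] lemma hom_ext {A : CommComon C} {X Y : Comod A} {f g : X ⟶ Y} (h : f.hom = g.hom) :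
    f = g := Hom.ext h

variable {A B M N K : CommComon C}

@[simp] lemma coact_del (X : Comod A) : X.coact ≫ del A X.X = 𝟙 _ := by
  rw [del, reassoc_of% X.coact_counit, Iso.inv_hom_id]

@[simp] lemma coact_del_assoc : type_of% (reassoc_of% @coact_del) :=
  @(reassoc_of% @coact_del)

lemma coact_dup (X : Comod A) : X.coact ≫ dup A X.X = X.coact ≫ X.coact ▷ A.X := by
  rw [dup, reassoc_of% X.coact_comul]; simp

lemma coact_dup_assoc : type_of% (reassoc_of% @coact_dup) :=
  @(reassoc_of% @coact_dup)

/-- Constructor for comodules. -/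
def mk' (X : C) (c : X ⟶ X ⊗ A.X) (h₁ : c ≫ del A X = 𝟙 X)
    (h₂ : c ≫ dup A X = c ≫ c ▷ A.X) : Comod A where
  X := X
  coact := c
  coact_counit := by
    rw [← cancel_mono (ρ_ X).hom, Category.assoc, Iso.inv_hom_id]; exact h₁
  coact_comul := by
    rw [← cancel_mono (α_ X A.X A.X).inv]
    simpa [dup] using h₂

/-- Restriction of scalars (pushforward) along a morphism of comonoids. -/
def push (p : M ⟶ A) : Comod M ⥤ Comod A where
  obj X := mk' X.X (X.coact ≫ X.X ◁ und p) (by simp) (by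
    rw [Category.assoc, Category.assoc, ← dup_hom, coact_dup_assoc, comp_whiskerRight,
      whisker_exchange_assoc, ← whisker_exchange])
  map {X Y} f := ⟨f.hom, by
    change f.hom ≫ Y.coact ≫ Y.X ◁ und p = (X.coact ≫ X.X ◁ und p) ≫ f.hom ▷ A.X
    rw [f.comm_assoc, Category.assoc, whisker_exchange]⟩

/-- A morphism of `C` between comodules over different comonoids that is compatible with the
coactions along a morphism of comonoids. -/
def IsOver (p : M ⟶ B) (X : Comod M) (Y : Comod B) (φ : X.X ⟶ Y.X) : Prop :=
  φ ≫ Y.coact = X.coact ≫ φ ▷ M.X ≫ Y.X ◁ und p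

section cotensor

variable (p : M ⟶ B) (Y : Comod B)

/-- The map `Y ⊗ M ⟶ (Y ⊗ B) ⊗ M` given by the coaction of `B` on `M` along `p`. -/
def coactR : Y.X ⊗ M.X ⟶ (Y.X ⊗ B.X) ⊗ M.X := dup M Y.X ≫ (Y.X ◁ und p) ▷ M.X

instance : IsCoreflexivePair (Y.coact ▷ M.X) (coactR p Y) :=
  IsCoreflexivePair.mk' (del B Y.X ▷ M.X) (by rw [← comp_whiskerRight]; simp)
    (by rw [coactR, Category.assoc, ← comp_whiskerRight]; simp)

variable [HasCoreflexiveEqualizers C]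

/-- The cotensor product `Y ⊗_B M`, as an object of `C`. -/
noncomputable def cotensor : C := equalizer (Y.coact ▷ M.X) (coactR p Y)

/-- The inclusion of the cotensor product in the tensor product. -/
noncomputable def incl : cotensor p Y ⟶ Y.X ⊗ M.X := equalizer.ι _ _

instance : Mono (incl p Y) := inferInstanceAs (Mono (equalizer.ι _ _))

lemma incl_condition : incl p Y ≫ Y.coact ▷ M.X = incl p Y ≫ coactR p Y :=
  equalizer.condition _ _

lemma incl_condition_assoc : type_of% (reassoc_of% @incl_condition) :=
  @(reassoc_of% @incl_condition)

lemma exists_lift {T : C} (j : T ⟶ Y.X ⊗ M.X) (h : j ≫ Y.coact ▷ M.X = j ≫ coactR p Y) :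
    ∃ k : T ⟶ cotensor p Y, k ≫ incl p Y = j :=
  ⟨equalizer.lift j h, equalizer.lift_ι j h⟩

variable [TensorPreservesCoreflexiveEqualizers C]

instance (X : C) : Mono (incl p Y ▷ X) := mono_right _ _ X

instance (X : C) : Mono (X ◁ incl p Y) := mono_left _ _ X

instance (X Z : C) : Mono (incl p Y ▷ X ▷ Z) := by
  have : incl p Y ▷ X ▷ Z = (α_ _ _ _).hom ≫ incl p Y ▷ (X ⊗ Z) ≫ (α_ _ _ _).inv := by simp
  rw [this]; infer_instance

lemma exists_coact : ∃ c : cotensor p Y ⟶ cotensor p Y ⊗ M.X,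
    c ≫ incl p Y ▷ M.X = incl p Y ≫ dup M Y.X := by
  apply exists_right
  rw [Category.assoc, Category.assoc, ← dup_natural, incl_condition_assoc]
  simp only [coactR, Category.assoc, comp_whiskerRight]
  rw [dup_natural, dup_dup_assoc]

/-- The coaction of `M` on `Y ⊗_B M`. -/
noncomputable def cotensorCoact : cotensor p Y ⟶ cotensor p Y ⊗ M.X := (exists_coact p Y).choose

lemma cotensorCoact_incl :
    cotensorCoact p Y ≫ incl p Y ▷ M.X = incl p Y ≫ dup M Y.X := (exists_coact p Y).choose_spec

lemma cotensorCoact_incl_assoc : type_of% (reassoc_of% @cotensorCoact_incl) :=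
  @(reassoc_of% @cotensorCoact_incl)

/-- Extension of scalars of a comodule along a morphism of comonoids: the `M`-comodule
`Y ⊗_B M`. -/
noncomputable def coextObj : Comod M := mk' (cotensor p Y) (cotensorCoact p Y)
  (by
    rw [← cancel_mono (incl p Y), Category.assoc, ← del_natural, cotensorCoact_incl_assoc]
    simp)
  (by
    rw [← cancel_mono (incl p Y ▷ M.X ▷ M.X)]
    simp only [Category.assoc]
    rw [← dup_natural, cotensorCoact_incl_assoc, dup_dup, ← comp_whiskerRight, cotensorCoact_incl,
      comp_whiskerRight, cotensorCoact_incl_assoc])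

end cotensor

end Comod

namespace Comod

open MonoidalCategory ComonObj ComodAux

variable {C : Type u} [Category.{v} C] [MonoidalCategory C] [SymmetricCategory C]
  {A B M N K : CommComon C}

lemma isOver_hom {X Y : Comod A} (f : X ⟶ Y) : IsOver (𝟙 A) X Y f.hom := by
  have := f.comm
  simpa [IsOver]

/-- A morphism over an identity is a morphism of comodules. -/
def IsOver.toHom {X Y : Comod A} {φ : X.X ⟶ Y.X} (h : IsOver (𝟙 A) X Y φ) : X ⟶ Y :=
  ⟨φ, by simpa [IsOver] using h⟩

@[simp] lemma IsOver.toHom_hom {X Y : Comod A} {φ : X.X ⟶ Y.X} (h : IsOver (𝟙 A) X Y φ) :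
    h.toHom.hom = φ := (rfl)

lemma IsOver.comp {p : K ⟶ M} {q : M ⟶ B} {X : Comod K} {Y : Comod M} {Z : Comod B}
    {φ : X.X ⟶ Y.X} {ψ : Y.X ⟶ Z.X} (h : IsOver p X Y φ) (h' : IsOver q Y Z ψ) :
    IsOver (p ≫ q) X Z (φ ≫ ψ) := by
  unfold IsOver at *
  rw [Category.assoc, h', reassoc_of% h, comp_whiskerRight_assoc, und_comp, whiskerLeft_comp,
    whisker_exchange_assoc]

lemma IsOver.comp_hom {p : K ⟶ M} {X : Comod K} {Y Z : Comod M}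
    {φ : X.X ⟶ Y.X} (h : IsOver p X Y φ) (f : Y ⟶ Z) : IsOver p X Z (φ ≫ f.hom) := by
  simpa using h.comp (isOver_hom f)

lemma IsOver.hom_comp {p : K ⟶ M} {X Y : Comod K} {Z : Comod M}
    {φ : Y.X ⟶ Z.X} (f : X ⟶ Y) (h : IsOver p Y Z φ) : IsOver p X Z (f.hom ≫ φ) := by
  simpa using (isOver_hom f).comp h

lemma IsOver.congr {p q : K ⟶ M} {X : Comod K} {Y : Comod M}
    {φ ψ : X.X ⟶ Y.X} (h : IsOver p X Y φ) (hp : p = q) (hφ : φ = ψ) : IsOver q X Y ψ := by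
  subst hp hφ; exact h

lemma push_coact (p : M ⟶ A) (X : Comod M) :
    ((push p).obj X).coact = X.coact ≫ X.X ◁ und p := (rfl)

lemma IsOver.from_push {p : K ⟶ M} {q : M ⟶ B} {X : Comod K} {Y : Comod B}
    {φ : X.X ⟶ Y.X} (h : IsOver (p ≫ q) X Y φ) : IsOver q ((push p).obj X) Y φ := by
  unfold IsOver at *
  refine h.trans (Eq.trans ?_ (Category.assoc _ _ _).symm)
  change _ = X.coact ≫ X.X ◁ und p ≫ φ ▷ M.X ≫ _
  rw [whisker_exchange_assoc, und_comp, whiskerLeft_comp]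

lemma IsOver.to_push {p : K ⟶ M} {q : M ⟶ B} {X : Comod K} {Y : Comod M}
    {φ : X.X ⟶ Y.X} (h : IsOver p X Y φ) : IsOver (p ≫ q) X ((push q).obj Y) φ := by
  unfold IsOver at *
  change φ ≫ Y.coact ≫ Y.X ◁ und q = _
  rw [reassoc_of% h]
  change X.coact ≫ _ = X.coact ≫ φ ▷ K.X ≫ Y.X ◁ und (p ≫ q)
  simp

section

variable [HasCoreflexiveEqualizers C] [TensorPreservesCoreflexiveEqualizers C]

/-- The inclusion `Y ⊗_B M ⟶ Y ⊗ M`. -/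
noncomputable def inc (p : M ⟶ B) (Y : Comod B) : (coextObj p Y).X ⟶ Y.X ⊗ M.X := incl p Y

instance (p : M ⟶ B) (Y : Comod B) : Mono (inc p Y) := inferInstanceAs (Mono (incl p Y))

instance (p : M ⟶ B) (Y : Comod B) (X : C) : Mono (inc p Y ▷ X) :=
  inferInstanceAs (Mono (incl p Y ▷ X))

lemma inc_condition (p : M ⟶ B) (Y : Comod B) :
    inc p Y ≫ Y.coact ▷ M.X = inc p Y ≫ coactR p Y := incl_condition p Y

lemma inc_condition_assoc : type_of% (reassoc_of% @inc_condition) :=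
  @(reassoc_of% @inc_condition)

lemma coact_inc (p : M ⟶ B) (Y : Comod B) :
    (coextObj p Y).coact ≫ inc p Y ▷ M.X = inc p Y ≫ dup M Y.X := cotensorCoact_incl p Y

lemma coact_inc_assoc : type_of% (reassoc_of% @coact_inc) :=
  @(reassoc_of% @coact_inc)

lemma exists_inc (p : M ⟶ B) (Y : Comod B) {T : C} (j : T ⟶ Y.X ⊗ M.X)
    (h : j ≫ Y.coact ▷ M.X = j ≫ coactR p Y) :
    ∃ k : T ⟶ (coextObj p Y).X, k ≫ inc p Y = j := exists_lift p Y j h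

/-- The projection `Y ⊗_B M ⟶ Y`. -/
noncomputable def proj (p : M ⟶ B) (Y : Comod B) : (coextObj p Y).X ⟶ Y.X := inc p Y ≫ del M Y.X

lemma coact_proj (p : M ⟶ B) (Y : Comod B) :
    (coextObj p Y).coact ≫ proj p Y ▷ M.X = inc p Y := by
  rw [proj, comp_whiskerRight, coact_inc_assoc, dup_del_right, Category.comp_id]

lemma isOver_proj (p : M ⟶ B) (Y : Comod B) : IsOver p (coextObj p Y) Y (proj p Y) := by
  have h := coact_proj p Y
  unfold IsOver
  rw [reassoc_of% h, proj, Category.assoc, ← del_natural, inc_condition_assoc, coactR,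
    Category.assoc, del_natural, dup_del_assoc]

lemma hom_inc {p : M ⟶ B} {Y : Comod B} {k : K ⟶ M} {X : Comod K} {a : X.X ⟶ (coextObj p Y).X}
    (h : IsOver k X (coextObj p Y) a) :
    a ≫ inc p Y = X.coact ≫ (a ≫ proj p Y) ▷ K.X ≫ Y.X ◁ und k := by
  unfold IsOver at h
  rw [← coact_proj, reassoc_of% h, whisker_exchange, comp_whiskerRight_assoc]

lemma ext_proj {p : M ⟶ B} {Y : Comod B} {k : K ⟶ M} {X : Comod K}
    {a b : X.X ⟶ (coextObj p Y).X} (ha : IsOver k X (coextObj p Y) a)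
    (hb : IsOver k X (coextObj p Y) b) (h : a ≫ proj p Y = b ≫ proj p Y) : a = b := by
  rw [← cancel_mono (inc p Y), hom_inc ha, hom_inc hb, h]

lemma exists_fill {p : M ⟶ B} {Y : Comod B} {k : K ⟶ M} {X : Comod K} {φ : X.X ⟶ Y.X}
    (h : IsOver (k ≫ p) X Y φ) :
    ∃ a : X.X ⟶ (coextObj p Y).X, a ≫ inc p Y = X.coact ≫ φ ▷ K.X ≫ Y.X ◁ und k := by
  apply exists_inc
  unfold IsOver at h
  simp only [Category.assoc, coactR]
  rw [whisker_exchange, ← comp_whiskerRight_assoc, h, ← dup_hom_assoc, dup_natural_assoc,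
    coact_dup_assoc, whisker_exchange]
  simp

/-- The universal property of extension of scalars. -/
noncomputable def fill {p : M ⟶ B} {Y : Comod B} {k : K ⟶ M} {X : Comod K} {φ : X.X ⟶ Y.X}
    (h : IsOver (k ≫ p) X Y φ) : X.X ⟶ (coextObj p Y).X := (exists_fill h).choose

lemma fill_inc {p : M ⟶ B} {Y : Comod B} {k : K ⟶ M} {X : Comod K} {φ : X.X ⟶ Y.X}
    (h : IsOver (k ≫ p) X Y φ) : fill h ≫ inc p Y = X.coact ≫ φ ▷ K.X ≫ Y.X ◁ und k :=
  (exists_fill h).choose_spec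

@[simp] lemma fill_proj {p : M ⟶ B} {Y : Comod B} {k : K ⟶ M} {X : Comod K}
    {φ : X.X ⟶ Y.X} (h : IsOver (k ≫ p) X Y φ) : fill h ≫ proj p Y = φ := by
  have e := fill_inc h
  rw [proj, reassoc_of% e, del_hom, del_natural, coact_del_assoc]

@[simp] lemma fill_proj_assoc : type_of% (reassoc_of% @fill_proj) :=
  @(reassoc_of% @fill_proj)

lemma isOver_fill {p : M ⟶ B} {Y : Comod B} {k : K ⟶ M} {X : Comod K} {φ : X.X ⟶ Y.X}
    (h : IsOver (k ≫ p) X Y φ) : IsOver k X (coextObj p Y) (fill h) := by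
  have e := fill_inc h
  unfold IsOver
  rw [← cancel_mono (inc p Y ▷ M.X)]
  simp only [Category.assoc]
  rw [coact_inc, reassoc_of% e, whisker_exchange, ← comp_whiskerRight_assoc, e,
    ← dup_hom, dup_natural_assoc, coact_dup_assoc]
  simp

lemma isOver_proj_map (p : M ⟶ B) {Y Z : Comod B} (f : Y ⟶ Z) :
    IsOver (𝟙 M ≫ p) (coextObj p Y) Z (proj p Y ≫ f.hom) :=
  ((isOver_proj p Y).comp_hom f).congr (by simp) rfl

/-- Extension of scalars along a morphism of comonoids: `Y ↦ Y ⊗_B M`. -/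
noncomputable def coext (p : M ⟶ B) : Comod B ⥤ Comod M where
  obj Y := coextObj p Y
  map {Y Z} f := (isOver_fill (isOver_proj_map p f)).toHom
  map_id Y := by
    ext
    refine ext_proj (isOver_hom _) (isOver_hom _) ?_
    simp
  map_comp f g := by
    ext
    refine ext_proj (isOver_hom _) (isOver_hom _) ?_
    simp

@[simp] lemma coext_obj (p : M ⟶ B) (Y : Comod B) : (coext p).obj Y = coextObj p Y := (rfl)

@[simp] lemma coext_map_proj (p : M ⟶ B) {Y Z : Comod B} (f : Y ⟶ Z) :
    ((coext p).map f).hom ≫ proj p Z = proj p Y ≫ f.hom :=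
  fill_proj (isOver_proj_map p f)

@[simp] lemma coext_map_proj_assoc : type_of% (reassoc_of% @coext_map_proj) :=
  @(reassoc_of% @coext_map_proj)

end

end Comod

/-! ### Pullbacks of commutative comonoids -/

namespace ComodAux

open MonoidalCategory ComonObj

variable {C : Type u} [Category.{v} C] [MonoidalCategory C] [SymmetricCategory C]

lemma comul_comul_split (N : C) [ComonObj N] :
    Δ[N] ≫ (Δ[N] ⊗ₘ Δ[N]) =
      Δ[N] ≫ N ◁ (Δ[N] ≫ Δ[N] ▷ N ≫ (α_ N N N).hom) ≫ (α_ N N (N ⊗ N)).inv := by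
  rw [← comul_assoc, whiskerLeft_comp, Category.assoc, associator_inv_naturality_right,
    ← comul_assoc_flip_assoc, MonoidalCategory.tensorHom_def]

lemma comul_isComonHom (N : C) [ComonObj N] [IsCommComonObj N] : IsComonHom Δ[N] where
  hom_counit := by
    rw [Comon.tensorObj_counit, MonoidalCategory.tensorHom_def, Category.assoc,
      counit_comul_assoc, ← leftUnitor_inv_naturality_assoc]
    simp
  hom_comul := by
    rw [Comon.tensorObj_comul, reassoc_of% comul_comul_split N, comul_comul_split N]
    have h : Δ[N] ≫ Δ[N] ▷ N ≫ (β_ N N).hom ▷ N = Δ[N] ≫ Δ[N] ▷ N := by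
      rw [← comp_whiskerRight, IsCommComonObj.comul_comm]
    simp only [tensorμ, Iso.inv_hom_id_assoc, ← whiskerLeft_comp_assoc, Category.assoc,
      Iso.hom_inv_id_assoc, reassoc_of% h]

lemma whiskerRight_isComonHom {M N : C} [ComonObj M] [ComonObj N] (f : M ⟶ N) [IsComonHom f]
    (X : C) [ComonObj X] : IsComonHom (f ▷ X) :=
  (MonoidalCategoryStruct.whiskerRight (C := Comon C)
    (show Comon.mk M ⟶ Comon.mk N from Comon.Hom.mk f) (Comon.mk X)).isComonHom_hom

lemma whiskerLeft_isComonHom {M N : C} [ComonObj M] [ComonObj N] (f : M ⟶ N) [IsComonHom f]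
    (X : C) [ComonObj X] : IsComonHom (X ◁ f) :=
  (MonoidalCategoryStruct.whiskerLeft (C := Comon C) (Comon.mk X)
    (show Comon.mk M ⟶ Comon.mk N from Comon.Hom.mk f)).isComonHom_hom

lemma assoc_isComonHom (X Y Z : C) [ComonObj X] [ComonObj Y] [ComonObj Z] :
    IsComonHom (α_ X Y Z).inv := by
  have h := (α_ (Comon.mk X) (Comon.mk Y) (Comon.mk Z)).inv.isComonHom_hom
  have e : (α_ (Comon.mk X) (Comon.mk Y) (Comon.mk Z)).inv.hom = (α_ X Y Z).inv := by
    have h' : X ◁ 𝟙 (Y ⊗ Z) ≫ (α_ X Y Z).inv ≫ 𝟙 (X ⊗ Y) ▷ Z = (α_ X Y Z).inv := by simp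
    refine Eq.trans ?_ h'
    simp only [Comon.monoidal_associator_inv_hom]
    rfl
  exact e ▸ h

/-- Constructor for morphisms of commutative comonoids. -/
def comHom {M N : CommComon C} (f : M.X ⟶ N.X) (h : IsComonHom f) : M ⟶ N :=
  InducedCategory.homMk (show M.toComon ⟶ N.toComon from { hom := f, isComonHom_hom := h })

@[simp] lemma und_comHom {M N : CommComon C} (f : M.X ⟶ N.X) (h : IsComonHom f) :
    und (comHom f h) = f := (rfl)

lemma und_isComonHom {M N : CommComon C} (f : M ⟶ N) : IsComonHom (und f) := f.hom.isComonHom_hom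

lemma und_ext {M N : CommComon C} {f g : M ⟶ N} (h : und f = und g) : f = g :=
  CommComon.hom_ext _ _ h

section equalizer

variable [HasCoreflexiveEqualizers C] [TensorPreservesCoreflexiveEqualizers C]
  {X Y : CommComon C} (f g : X ⟶ Y) [IsCoreflexivePair (und f) (und g)]

/-- The underlying object of the equalizer of a coreflexive pair. -/
noncomputable def eqObj : C := equalizer (und f) (und g)

/-- The inclusion of the equalizer. -/
noncomputable def eqInc : eqObj f g ⟶ X.X := equalizer.ι _ _

lemma exists_eqLeft {Z T : C} (j : T ⟶ Z ⊗ X.X) (h : j ≫ Z ◁ und f = j ≫ Z ◁ und g) :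
    ∃ k : T ⟶ Z ⊗ eqObj f g, k ≫ Z ◁ eqInc f g = j := exists_left _ _ j h

lemma exists_eqRight {Z T : C} (j : T ⟶ X.X ⊗ Z) (h : j ≫ und f ▷ Z = j ≫ und g ▷ Z) :
    ∃ k : T ⟶ eqObj f g ⊗ Z, k ≫ eqInc f g ▷ Z = j := exists_right _ _ j h

lemma eqInc_condition : eqInc f g ≫ und f = eqInc f g ≫ und g := equalizer.condition _ _

lemma eqInc_condition_assoc : type_of% (reassoc_of% @eqInc_condition) :=
  @(reassoc_of% @eqInc_condition)

instance : Mono (eqInc f g) := inferInstanceAs (Mono (equalizer.ι _ _))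

instance (Z : C) : Mono (eqInc f g ▷ Z) := mono_right _ _ Z

instance (Z : C) : Mono (Z ◁ eqInc f g) := mono_left _ _ Z

instance : Mono (eqInc f g ⊗ₘ eqInc f g) := by
  rw [MonoidalCategory.tensorHom_def]; infer_instance

instance : Mono (eqInc f g ⊗ₘ (eqInc f g ⊗ₘ eqInc f g)) := by
  rw [MonoidalCategory.tensorHom_def, MonoidalCategory.tensorHom_def, whiskerLeft_comp]
  have : Mono (X.X ◁ eqInc f g ▷ eqObj f g) := by
    have e : X.X ◁ eqInc f g ▷ eqObj f g = X.X ◁ (β_ _ _).hom ≫ (α_ _ _ _).inv ≫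
        (X.X ⊗ eqObj f g) ◁ eqInc f g ≫ (α_ _ _ _).hom ≫ X.X ◁ (β_ _ _).inv := by
      simp [← whiskerLeft_comp]
    rw [e]; infer_instance
  have : Mono (X.X ◁ X.X ◁ eqInc f g) := by
    have e' : X.X ◁ X.X ◁ eqInc f g =
        (α_ _ _ _).inv ≫ (X.X ⊗ X.X) ◁ eqInc f g ≫ (α_ _ _ _).hom := by simp
    rw [e']; infer_instance
  infer_instance

lemma exists_eqComul : ∃ c : eqObj f g ⟶ eqObj f g ⊗ eqObj f g,
    c ≫ (eqInc f g ⊗ₘ eqInc f g) = eqInc f g ≫ Δ[X.X] := by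
  let s := commonRetraction (und f) (und g)
  have h₁ (a : X ⟶ Y) (ha : und a ≫ s = 𝟙 _) :
      Δ[X.X] ≫ X.X ◁ und a = und a ≫ Δ[Y.X] ≫ s ▷ Y.X := by
    have : und a ▷ X.X ≫ s ▷ X.X = 𝟙 _ := by rw [← comp_whiskerRight, ha, id_whiskerRight]
    rw [und_comul_assoc, whisker_exchange, reassoc_of% this]
  have h₂ (a : X ⟶ Y) (ha : und a ≫ s = 𝟙 _) :
      Δ[X.X] ≫ und a ▷ X.X = und a ≫ Δ[Y.X] ≫ Y.X ◁ s := by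
    rw [und_comul_assoc, ← whiskerLeft_comp, ha, whiskerLeft_id, Category.comp_id]
  have hf := left_comp_retraction (und f) (und g)
  have hg := right_comp_retraction (und f) (und g)
  have hc := eqInc_condition f g
  obtain ⟨k, hk⟩ := exists_eqLeft f g (eqInc f g ≫ Δ[X.X]) (by
    simp only [Category.assoc]
    rw [h₁ f hf, h₁ g hg, reassoc_of% hc])
  obtain ⟨c, hc⟩ := exists_eqRight f g k (by
    rw [← cancel_mono (Y.X ◁ eqInc f g)]
    simp only [Category.assoc]
    rw [← whisker_exchange, ← whisker_exchange, reassoc_of% hk, reassoc_of% hk,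
      h₂ f hf, h₂ g hg, reassoc_of% hc])
  exact ⟨c, by rw [MonoidalCategory.tensorHom_def, reassoc_of% hc, hk]⟩

/-- The comultiplication of the equalizer. -/
noncomputable def eqComul : eqObj f g ⟶ eqObj f g ⊗ eqObj f g := (exists_eqComul f g).choose

lemma eqComul_inc :
    eqComul f g ≫ (eqInc f g ⊗ₘ eqInc f g) = eqInc f g ≫ Δ[X.X] :=
  (exists_eqComul f g).choose_spec

lemma eqComul_inc_assoc : type_of% (reassoc_of% @eqComul_inc) :=
  @(reassoc_of% @eqComul_inc)

@[simps] noncomputable instance : ComonObj (eqObj f g) where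
  counit := eqInc f g ≫ ε[X.X]
  comul := eqComul f g
  counit_comul := by
    have : Mono (𝟙_ C ◁ eqInc f g) := inferInstance
    rw [← cancel_mono (𝟙_ C ◁ eqInc f g), ← leftUnitor_inv_naturality, ← counit_comul,
      ← eqComul_inc_assoc, MonoidalCategory.tensorHom_def]
    simp only [comp_whiskerRight, Category.assoc]
    rw [whisker_exchange]
  comul_counit := by
    rw [← cancel_mono (eqInc f g ▷ 𝟙_ C), ← rightUnitor_inv_naturality, ← comul_counit,
      ← eqComul_inc_assoc, MonoidalCategory.tensorHom_def]
    simp only [whiskerLeft_comp, Category.assoc]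
    rw [whisker_exchange, whisker_exchange_assoc]
  comul_assoc := by
    rw [← cancel_mono (eqInc f g ⊗ₘ (eqInc f g ⊗ₘ eqInc f g))]
    have h₁ : (eqComul f g ≫ eqObj f g ◁ eqComul f g) ≫ (eqInc f g ⊗ₘ (eqInc f g ⊗ₘ eqInc f g)) =
        eqInc f g ≫ Δ[X.X] ≫ X.X ◁ Δ[X.X] := by
      rw [Category.assoc, whiskerLeft_comp_tensorHom, eqComul_inc, ← eqComul_inc_assoc,
        tensorHom_comp_whiskerLeft]
    have h₂ : (eqComul f g ≫ eqComul f g ▷ eqObj f g ≫ (α_ _ _ _).hom) ≫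
        (eqInc f g ⊗ₘ (eqInc f g ⊗ₘ eqInc f g)) =
        eqInc f g ≫ Δ[X.X] ≫ Δ[X.X] ▷ X.X ≫ (α_ _ _ _).hom := by
      simp only [Category.assoc]
      rw [← associator_naturality, whiskerRight_comp_tensorHom_assoc, eqComul_inc,
        ← eqComul_inc_assoc, tensorHom_comp_whiskerRight_assoc]
    rw [h₁, h₂, comul_assoc]

instance : IsCommComonObj (eqObj f g) where
  comul_comm := by
    rw [← cancel_mono (eqInc f g ⊗ₘ eqInc f g)]
    change (eqComul f g ≫ _) ≫ _ = eqComul f g ≫ _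
    rw [Category.assoc, ← BraidedCategory.braiding_naturality, eqComul_inc, eqComul_inc_assoc,
      IsCommComonObj.comul_comm]

/-- The equalizer of a coreflexive pair, as a commutative comonoid. -/
noncomputable def eqCom : CommComon C := ⟨eqObj f g⟩

/-- The inclusion of the equalizer, as a morphism of comonoids. -/
noncomputable def eqComInc : eqCom f g ⟶ X :=
  comHom (eqInc f g) ⟨rfl, (eqComul_inc f g).symm⟩

instance : Mono (und (eqComInc f g)) := inferInstanceAs (Mono (eqInc f g))

lemma eqComInc_condition : eqComInc f g ≫ f = eqComInc f g ≫ g :=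
  und_ext (eqInc_condition f g)

lemma exists_eqCom {T : CommComon C} (h : T ⟶ X) (hfg : h ≫ f = h ≫ g) :
    ∃ k : T ⟶ eqCom f g, k ≫ eqComInc f g = h := by
  let k : T.X ⟶ eqObj f g := equalizer.lift (und h) (by
    simpa using congrArg und hfg)
  have hk : k ≫ eqInc f g = und h := equalizer.lift_ι _ _
  have := und_isComonHom h
  refine ⟨comHom k ⟨?_, ?_⟩, und_ext hk⟩
  · change k ≫ eqInc f g ≫ ε[X.X] = _
    rw [reassoc_of% hk, und_counit]
  · change k ≫ eqComul f g = Δ[T.X] ≫ (k ⊗ₘ k)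
    rw [← cancel_mono (eqInc f g ⊗ₘ eqInc f g)]
    simp only [Category.assoc, MonoidalCategory.tensorHom_comp_tensorHom]
    rw [eqComul_inc, reassoc_of% hk]
    refine (IsComonHom.hom_comul (und h)).trans ?_
    exact congrArg (fun t => Δ[T.X] ≫ (t ⊗ₘ t)) hk.symm

end equalizer

end ComodAux

namespace ComodAux

open MonoidalCategory ComonObj

variable {C : Type u} [Category.{v} C] [MonoidalCategory C] [SymmetricCategory C]
  {B M N T : CommComon C}

lemma comp_isComonHom {X Y Z : C} [ComonObj X] [ComonObj Y] [ComonObj Z] (f : X ⟶ Y) (g : Y ⟶ Z)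
    [IsComonHom f] [IsComonHom g] : IsComonHom (f ≫ g) := inferInstance

/-- The first projection from a tensor product of comonoids. -/
def prFst (N M : CommComon C) : N.X ⊗ M.X ⟶ N.X := N.X ◁ ε[M.X] ≫ (ρ_ N.X).hom

/-- The second projection from a tensor product of comonoids. -/
def prSnd (N M : CommComon C) : N.X ⊗ M.X ⟶ M.X := ε[N.X] ▷ M.X ≫ (λ_ M.X).hom

lemma comul_prFst_prSnd (N M : CommComon C) :
    Δ[N.X ⊗ M.X] ≫ (prFst N M ⊗ₘ prSnd N M) = 𝟙 _ := by
  have h := tensorμ_natural (𝟙 N.X) ε[N.X] ε[M.X] (𝟙 M.X)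
  have e : (prFst N M ⊗ₘ prSnd N M) = ((𝟙 N.X ⊗ₘ ε[M.X]) ⊗ₘ (ε[N.X] ⊗ₘ 𝟙 M.X)) ≫
      ((ρ_ N.X).hom ⊗ₘ (λ_ M.X).hom) := by
    simp [prFst, prSnd]
  rw [Comon.tensorObj_comul, e, Category.assoc, ← reassoc_of% h,
    MonoidalCategory.tensorHom_comp_tensorHom_assoc, id_tensorHom, tensorHom_id, comul_counit,
    counit_comul]
  have h' : tensorμ N.X (𝟙_ C) (𝟙_ C) M.X = 𝟙 _ := by
    have : (β_ (𝟙_ C) (𝟙_ C)).hom = 𝟙 _ := by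
      simp [← unitors_equal]
    simp [tensorμ, this]
  rw [h', Category.id_comp, MonoidalCategory.tensorHom_comp_tensorHom]
  simp

lemma prFst_isComonHom (N M : CommComon C) : IsComonHom (prFst N M) where
  hom_counit := by
    rw [Comon.tensorObj_counit, MonoidalCategory.tensorHom_def', prFst, unitors_equal]
    simp
  hom_comul := by
    have h := tensorμ_natural (𝟙 N.X) (𝟙 N.X) ε[M.X] ε[M.X]
    have e : (prFst N M ⊗ₘ prFst N M) = ((𝟙 N.X ⊗ₘ ε[M.X]) ⊗ₘ (𝟙 N.X ⊗ₘ ε[M.X])) ≫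
        ((ρ_ N.X).hom ⊗ₘ (ρ_ N.X).hom) := by
      simp [prFst]
    have e' : Δ[M.X] ≫ (ε[M.X] ⊗ₘ ε[M.X]) = ε[M.X] ≫ (λ_ (𝟙_ C)).inv := by
      simp [unitors_inv_equal]
    rw [Comon.tensorObj_comul, e, Category.assoc, ← reassoc_of% h,
      MonoidalCategory.tensorHom_comp_tensorHom_assoc, e', id_tensorHom_id, Category.comp_id]
    have h' := tensor_right_unitality N.X N.X
    have e'' : (Δ[N.X] ⊗ₘ ε[M.X] ≫ (λ_ (𝟙_ C)).inv) =
        (Δ[N.X] ⊗ₘ ε[M.X]) ≫ (N.X ⊗ N.X) ◁ (λ_ (𝟙_ C)).inv := by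
      rw [MonoidalCategory.tensorHom_def, MonoidalCategory.tensorHom_def, whiskerLeft_comp,
        Category.assoc]
    rw [e'', Category.assoc, ← h', MonoidalCategory.tensorHom_def', Category.assoc,
      rightUnitor_naturality, prFst, Category.assoc]

lemma prSnd_isComonHom (N M : CommComon C) : IsComonHom (prSnd N M) where
  hom_counit := by
    rw [Comon.tensorObj_counit, MonoidalCategory.tensorHom_def, prSnd]
    simp
  hom_comul := by
    have h := tensorμ_natural ε[N.X] ε[N.X] (𝟙 M.X) (𝟙 M.X)
    have e : (prSnd N M ⊗ₘ prSnd N M) = ((ε[N.X] ⊗ₘ 𝟙 M.X) ⊗ₘ (ε[N.X] ⊗ₘ 𝟙 M.X)) ≫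
        ((λ_ M.X).hom ⊗ₘ (λ_ M.X).hom) := by
      simp [prSnd]
    have e' : Δ[N.X] ≫ (ε[N.X] ⊗ₘ ε[N.X]) = ε[N.X] ≫ (λ_ (𝟙_ C)).inv := by
      simp [unitors_inv_equal]
    rw [Comon.tensorObj_comul, e, Category.assoc, ← reassoc_of% h,
      MonoidalCategory.tensorHom_comp_tensorHom_assoc, e', id_tensorHom_id, Category.comp_id]
    have h' := tensor_left_unitality M.X M.X
    have e'' : (ε[N.X] ≫ (λ_ (𝟙_ C)).inv ⊗ₘ Δ[M.X]) =
        (ε[N.X] ⊗ₘ Δ[M.X]) ≫ (λ_ (𝟙_ C)).inv ▷ (M.X ⊗ M.X) := by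
      rw [MonoidalCategory.tensorHom_def', MonoidalCategory.tensorHom_def', comp_whiskerRight,
        Category.assoc]
    rw [e'', Category.assoc, ← h', MonoidalCategory.tensorHom_def, Category.assoc,
      leftUnitor_naturality, prSnd, Category.assoc]

/-- The tensor product of commutative comonoids. -/
def tens (N M : CommComon C) : CommComon C := ⟨N.X ⊗ M.X⟩

/-- The morphism of comonoids into a tensor product with given components. -/
def pair (y : T ⟶ N) (x : T ⟶ M) : T ⟶ tens N M :=
  comHom (Δ[T.X] ≫ (und y ⊗ₘ und x)) (by
    have := comul_isComonHom T.X
    have := und_isComonHom y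
    have := und_isComonHom x
    have := whiskerRight_isComonHom (und y) T.X
    have := whiskerLeft_isComonHom (und x) N.X
    have : IsComonHom (und y ⊗ₘ und x) := by
      rw [MonoidalCategory.tensorHom_def]; infer_instance
    exact inferInstanceAs (IsComonHom (Δ[T.X] ≫ (und y ⊗ₘ und x))))

variable (q : M ⟶ B) (r : N ⟶ B)

/-- The first of the two morphisms whose equalizer is the pullback. -/
def d₀ : tens N M ⟶ tens (tens N B) M :=
  comHom ((Δ[N.X] ≫ N.X ◁ und r) ▷ M.X) (by
    have := comul_isComonHom N.X
    have := und_isComonHom r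
    have := whiskerLeft_isComonHom (und r) N.X
    have := comp_isComonHom Δ[N.X] (N.X ◁ und r)
    have h := whiskerRight_isComonHom (Δ[N.X] ≫ N.X ◁ und r) M.X
    exact h)

/-- The second of the two morphisms whose equalizer is the pullback. -/
def d₁ : tens N M ⟶ tens (tens N B) M :=
  comHom (N.X ◁ (Δ[M.X] ≫ und q ▷ M.X) ≫ (α_ N.X B.X M.X).inv) (by
    have := comul_isComonHom M.X
    have := und_isComonHom q
    have := whiskerRight_isComonHom (und q) M.X
    have := comp_isComonHom Δ[M.X] (und q ▷ M.X)
    have := whiskerLeft_isComonHom (Δ[M.X] ≫ und q ▷ M.X) N.X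
    have := assoc_isComonHom N.X B.X M.X
    exact inferInstanceAs (IsComonHom (N.X ◁ (Δ[M.X] ≫ und q ▷ M.X) ≫ (α_ N.X B.X M.X).inv)))

/-- The first projection, as a morphism of comonoids. -/
def fstHom (N M : CommComon C) : tens N M ⟶ N := comHom (prFst N M) (prFst_isComonHom N M)

/-- The second projection, as a morphism of comonoids. -/
def sndHom (N M : CommComon C) : tens N M ⟶ M := comHom (prSnd N M) (prSnd_isComonHom N M)

@[simp] lemma pair_fstHom (y : T ⟶ N) (x : T ⟶ M) :
    pair y x ≫ fstHom N M = y := by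
  apply und_ext
  change (Δ[T.X] ≫ (und y ⊗ₘ und x)) ≫ N.X ◁ ε[M.X] ≫ (ρ_ N.X).hom = und y
  rw [Category.assoc, tensorHom_comp_whiskerLeft_assoc, und_counit,
    MonoidalCategory.tensorHom_def', Category.assoc, comul_counit_assoc]
  simp

@[simp] lemma pair_fstHom_assoc : type_of% (reassoc_of% @pair_fstHom) :=
  @(reassoc_of% @pair_fstHom)

@[simp] lemma pair_sndHom (y : T ⟶ N) (x : T ⟶ M) :
    pair y x ≫ sndHom N M = x := by
  apply und_ext
  change (Δ[T.X] ≫ (und y ⊗ₘ und x)) ≫ ε[N.X] ▷ M.X ≫ (λ_ M.X).hom = und x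
  rw [Category.assoc, tensorHom_comp_whiskerRight_assoc, und_counit,
    MonoidalCategory.tensorHom_def, Category.assoc, counit_comul_assoc]
  simp

@[simp] lemma pair_sndHom_assoc : type_of% (reassoc_of% @pair_sndHom) :=
  @(reassoc_of% @pair_sndHom)

lemma eq_comul_tensor (h : T.X ⟶ N.X ⊗ M.X) [IsComonHom h] :
    h = Δ[T.X] ≫ (h ≫ prFst N M ⊗ₘ h ≫ prSnd N M) := by
  rw [← MonoidalCategory.tensorHom_comp_tensorHom, ← IsComonHom.hom_comul_assoc,
    comul_prFst_prSnd, Category.comp_id]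

lemma eq_pair (h : T ⟶ tens N M) : h = pair (h ≫ fstHom N M) (h ≫ sndHom N M) :=
  und_ext (@eq_comul_tensor _ _ _ _ _ _ _ (und h) (und_isComonHom h))

lemma pair_hom_ext {h k : T ⟶ tens N M} (h₁ : h ≫ fstHom N M = k ≫ fstHom N M)
    (h₂ : h ≫ sndHom N M = k ≫ sndHom N M) : h = k := by
  rw [eq_pair h, eq_pair k, h₁, h₂]

lemma d₀_snd : d₀ (M := M) r ≫ sndHom _ _ = sndHom _ _ := by
  apply und_ext
  change (Δ[N.X] ≫ N.X ◁ und r) ▷ M.X ≫ ε[N.X ⊗ B.X] ▷ M.X ≫ (λ_ M.X).hom =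
    ε[N.X] ▷ M.X ≫ (λ_ M.X).hom
  have := comul_isComonHom N.X
  have := und_isComonHom r
  have := whiskerLeft_isComonHom (und r) N.X
  have := comp_isComonHom Δ[N.X] (N.X ◁ und r)
  rw [← comp_whiskerRight_assoc, IsComonHom.hom_counit]

lemma d₀_fst_fst : d₀ (M := M) r ≫ fstHom _ _ ≫ fstHom _ _ = fstHom _ _ := by
  apply und_ext
  change (Δ[N.X] ≫ N.X ◁ und r) ▷ M.X ≫ ((N.X ⊗ B.X) ◁ ε[M.X] ≫ (ρ_ (N.X ⊗ B.X)).hom) ≫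
    N.X ◁ ε[B.X] ≫ (ρ_ N.X).hom = N.X ◁ ε[M.X] ≫ (ρ_ N.X).hom
  rw [Category.assoc, ← whisker_exchange_assoc, rightUnitor_naturality_assoc, Category.assoc,
    ← whiskerLeft_comp_assoc, und_counit, comul_counit_assoc, Iso.inv_hom_id, Category.comp_id]

lemma d₀_fst_snd : d₀ (M := M) r ≫ fstHom _ _ ≫ sndHom _ _ = fstHom _ _ ≫ r := by
  apply und_ext
  change (Δ[N.X] ≫ N.X ◁ und r) ▷ M.X ≫ ((N.X ⊗ B.X) ◁ ε[M.X] ≫ (ρ_ (N.X ⊗ B.X)).hom) ≫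
    ε[N.X] ▷ B.X ≫ (λ_ B.X).hom = (N.X ◁ ε[M.X] ≫ (ρ_ N.X).hom) ≫ und r
  rw [Category.assoc, ← whisker_exchange_assoc, rightUnitor_naturality_assoc, Category.assoc,
    whisker_exchange_assoc, counit_comul_assoc, leftUnitor_naturality, Iso.inv_hom_id_assoc,
    Category.assoc]

lemma d₁_snd : d₁ (N := N) q ≫ sndHom _ _ = sndHom _ _ := by
  apply und_ext
  change (N.X ◁ (Δ[M.X] ≫ und q ▷ M.X) ≫ (α_ N.X B.X M.X).inv) ≫ ε[N.X ⊗ B.X] ▷ M.X ≫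
    (λ_ M.X).hom = ε[N.X] ▷ M.X ≫ (λ_ M.X).hom
  have e : (α_ N.X B.X M.X).inv ≫ ε[N.X ⊗ B.X] ▷ M.X ≫ (λ_ M.X).hom =
      N.X ◁ (ε[B.X] ▷ M.X ≫ (λ_ M.X).hom) ≫ ε[N.X] ▷ M.X ≫ (λ_ M.X).hom := by
    rw [Comon.tensorObj_counit, MonoidalCategory.tensorHom_def, whisker_exchange_assoc]
    simp
  rw [Category.assoc, e, ← whiskerLeft_comp_assoc, Category.assoc, ← comp_whiskerRight_assoc,
    und_counit, counit_comul_assoc, Iso.inv_hom_id, whiskerLeft_id, Category.id_comp]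

lemma d₁_fst_fst : d₁ (N := N) q ≫ fstHom _ _ ≫ fstHom _ _ = fstHom _ _ := by
  apply und_ext
  change (N.X ◁ (Δ[M.X] ≫ und q ▷ M.X) ≫ (α_ N.X B.X M.X).inv) ≫
    ((N.X ⊗ B.X) ◁ ε[M.X] ≫ (ρ_ (N.X ⊗ B.X)).hom) ≫
    N.X ◁ ε[B.X] ≫ (ρ_ N.X).hom = N.X ◁ ε[M.X] ≫ (ρ_ N.X).hom
  have e : (α_ N.X B.X M.X).inv ≫ ((N.X ⊗ B.X) ◁ ε[M.X] ≫ (ρ_ (N.X ⊗ B.X)).hom) ≫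
    N.X ◁ ε[B.X] = N.X ◁ (B.X ◁ ε[M.X] ≫ (ρ_ B.X).hom ≫ ε[B.X]) := by
    simp
  simp only [Category.assoc] at e ⊢
  rw [reassoc_of% e, ← whiskerLeft_comp_assoc, Category.assoc,
    ← whisker_exchange_assoc, comul_counit_assoc, rightUnitor_naturality_assoc,
    Iso.inv_hom_id_assoc, und_counit]

lemma d₁_fst_snd : d₁ (N := N) q ≫ fstHom _ _ ≫ sndHom _ _ = sndHom _ _ ≫ q := by
  apply und_ext
  change (N.X ◁ (Δ[M.X] ≫ und q ▷ M.X) ≫ (α_ N.X B.X M.X).inv) ≫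
    ((N.X ⊗ B.X) ◁ ε[M.X] ≫ (ρ_ (N.X ⊗ B.X)).hom) ≫
    ε[N.X] ▷ B.X ≫ (λ_ B.X).hom = (ε[N.X] ▷ M.X ≫ (λ_ M.X).hom) ≫ und q
  have e : (α_ N.X B.X M.X).inv ≫ ((N.X ⊗ B.X) ◁ ε[M.X] ≫ (ρ_ (N.X ⊗ B.X)).hom) =
    N.X ◁ (B.X ◁ ε[M.X] ≫ (ρ_ B.X).hom) := by
    simp
  simp only [Category.assoc] at e ⊢
  rw [reassoc_of% e, ← whiskerLeft_comp_assoc, Category.assoc,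
    ← whisker_exchange_assoc, comul_counit_assoc, rightUnitor_naturality,
    Iso.inv_hom_id_assoc, whisker_exchange_assoc, leftUnitor_naturality]

lemma comp_d₀_eq_comp_d₁_iff (h : T ⟶ tens N M) :
    h ≫ d₀ r = h ≫ d₁ q ↔ h ≫ fstHom N M ≫ r = h ≫ sndHom N M ≫ q := by
  rw [← d₀_fst_snd, ← d₁_fst_snd]
  constructor
  · intro e
    rw [reassoc_of% e]
  · intro e
    refine pair_hom_ext (pair_hom_ext ?_ ?_) ?_
    · simp only [Category.assoc]
      rw [d₀_fst_fst, d₁_fst_fst]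
    · simp only [Category.assoc]
      exact e
    · simp only [Category.assoc]
      rw [d₀_snd, d₁_snd]

instance : IsCoreflexivePair (und (d₀ (M := M) r)) (und (d₁ (N := N) q)) := by
  have h₀ : d₀ (M := M) r ≫ pair (fstHom _ _ ≫ fstHom _ _) (sndHom _ _) = 𝟙 (tens N M) :=
    pair_hom_ext (by simp [d₀_fst_fst]) (by simp [d₀_snd])
  have h₁ : d₁ (N := N) q ≫ pair (fstHom _ _ ≫ fstHom _ _) (sndHom _ _) = 𝟙 (tens N M) :=
    pair_hom_ext (by simp [d₁_fst_fst]) (by simp [d₁_snd])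
  exact IsCoreflexivePair.mk' (und (pair (fstHom _ _ ≫ fstHom _ _) (sndHom _ _)))
    (by rw [← und_comp, h₀, und_id]) (by rw [← und_comp, h₁, und_id])

section

variable [HasCoreflexiveEqualizers C] [TensorPreservesCoreflexiveEqualizers C]

/-- The pullback of commutative comonoids. -/
noncomputable abbrev pbObj : CommComon C := eqCom (d₀ r) (d₁ q)

/-- The first projection from the pullback. -/
noncomputable def pbFst : pbObj q r ⟶ M := eqComInc (d₀ r) (d₁ q) ≫ sndHom N M

/-- The second projection from the pullback. -/
noncomputable def pbSnd : pbObj q r ⟶ N := eqComInc (d₀ r) (d₁ q) ≫ fstHom N M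

lemma isPullback_pb : IsPullback (pbFst q r) (pbSnd q r) q r where
  w := by
    have := (comp_d₀_eq_comp_d₁_iff q r _).1 (eqComInc_condition (d₀ r) (d₁ q))
    rw [pbFst, pbSnd, Category.assoc, Category.assoc, this]
  isLimit' := by
    have h (s : PullbackCone q r) :=
      exists_eqCom (d₀ r) (d₁ q) (pair s.snd s.fst) (by
        rw [comp_d₀_eq_comp_d₁_iff, pair_fstHom_assoc, pair_sndHom_assoc, s.condition])
    choose k hk using h
    refine ⟨PullbackCone.IsLimit.mk _ k (fun s => ?_) (fun s => ?_) (fun s m h₁ h₂ => ?_)⟩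
    · rw [pbFst, reassoc_of% hk s, pair_sndHom]
    · rw [pbSnd, reassoc_of% hk s, pair_fstHom]
    · apply und_ext
      rw [← cancel_mono (und (eqComInc (d₀ r) (d₁ q))), ← und_comp, ← und_comp, hk]
      refine congrArg und (pair_hom_ext ?_ ?_)
      · rw [pair_fstHom, ← h₂, pbSnd, Category.assoc]
      · rw [pair_sndHom, ← h₁, pbFst, Category.assoc]

instance : HasPullbacks (CommComon C) :=
  have {X Y Z : CommComon C} {f : X ⟶ Z} {g : Y ⟶ Z} : HasLimit (cospan f g) :=
    (isPullback_pb f g).hasPullback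
  hasPullbacks_of_hasLimit_cospan _

end

end ComodAux

namespace ComodAux

open MonoidalCategory ComonObj

variable {C : Type u} [Category.{v} C] [MonoidalCategory C] [SymmetricCategory C]
  {B M N P Q : CommComon C}

/-- The map `X ⊗ P ⟶ (X ⊗ N) ⊗ M` induced by morphisms of comonoids `P ⟶ M` and `P ⟶ N`. -/
def spread (p₁ : P ⟶ M) (p₂ : P ⟶ N) (X : C) : X ⊗ P.X ⟶ (X ⊗ N.X) ⊗ M.X :=
  dup P X ≫ (X ◁ und p₂) ▷ P.X ≫ (X ⊗ N.X) ◁ und p₁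

lemma whiskerLeft_spread (k : Q ⟶ P) (p₁ : P ⟶ M) (p₂ : P ⟶ N) (X : C) :
    X ◁ und k ≫ spread p₁ p₂ X = spread (k ≫ p₁) (k ≫ p₂) X := by
  rw [spread, ← dup_hom_assoc, spread, whisker_exchange_assoc, ← comp_whiskerRight_assoc,
    ← whiskerLeft_comp, ← whiskerLeft_comp, und_comp, und_comp]

lemma whiskerLeft_spread_assoc : type_of% (reassoc_of% @whiskerLeft_spread) :=
  @(reassoc_of% @whiskerLeft_spread)

lemma spread_proj (N M : CommComon C) (X : C) :
    spread (sndHom N M) (fstHom N M) X = (α_ X N.X M.X).inv := by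
  have h : spread (sndHom N M) (fstHom N M) X =
      X ◁ (Δ[N.X ⊗ M.X] ≫ (prFst N M ⊗ₘ prSnd N M)) ≫ (α_ X N.X M.X).inv := by
    rw [MonoidalCategory.tensorHom_def]
    change (X ◁ Δ[N.X ⊗ M.X] ≫ (α_ X (N.X ⊗ M.X) (N.X ⊗ M.X)).inv) ≫
      (X ◁ prFst N M) ▷ (N.X ⊗ M.X) ≫ (X ⊗ N.X) ◁ prSnd N M = _
    generalize Δ[N.X ⊗ M.X] = d
    generalize prFst N M = a
    generalize prSnd N M = b
    monoidal
  rw [h, comul_prFst_prSnd, whiskerLeft_id, Category.id_comp]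

variable [HasCoreflexiveEqualizers C] [TensorPreservesCoreflexiveEqualizers C]

/-- The inclusion of the pullback in the tensor product. -/
noncomputable def pbInc (q : M ⟶ B) (r : N ⟶ B) : (pbObj q r).X ⟶ N.X ⊗ M.X :=
  eqInc (d₀ r) (d₁ q)

instance (q : M ⟶ B) (r : N ⟶ B) (X : C) : Mono (X ◁ pbInc q r) :=
  inferInstanceAs (Mono (X ◁ eqInc (d₀ r) (d₁ q)))

lemma exists_pbInc (q : M ⟶ B) (r : N ⟶ B) {X T : C} (j : T ⟶ X ⊗ (N.X ⊗ M.X))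
    (h : j ≫ X ◁ (Δ[N.X] ≫ N.X ◁ und r) ▷ M.X =
      j ≫ X ◁ (N.X ◁ (Δ[M.X] ≫ und q ▷ M.X) ≫ (α_ N.X B.X M.X).inv)) :
    ∃ k : T ⟶ X ⊗ (pbObj q r).X, k ≫ X ◁ pbInc q r = j :=
  exists_eqLeft (d₀ r) (d₁ q) j h

lemma spread_pb (q : M ⟶ B) (r : N ⟶ B) (X : C) :
    spread (pbFst q r) (pbSnd q r) X = X ◁ pbInc q r ≫ (α_ X N.X M.X).inv :=
  (whiskerLeft_spread (eqComInc (d₀ r) (d₁ q)) (sndHom N M) (fstHom N M) X).symm.trans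
    (congrArg _ (spread_proj N M X))

variable {q : M ⟶ B} {r : N ⟶ B} {p₁ : P ⟶ M} {p₂ : P ⟶ N}

lemma spread_eq (h : IsPullback p₁ p₂ q r) (X : C) :
    spread p₁ p₂ X = (X ◁ und (h.isoIsPullback _ _ (isPullback_pb q r)).hom) ≫
      X ◁ pbInc q r ≫ (α_ X N.X M.X).inv := by
  rw [← spread_pb]
  refine Eq.trans ?_ (whiskerLeft_spread _ _ _ _).symm
  rw [IsPullback.isoIsPullback_hom_fst, IsPullback.isoIsPullback_hom_snd]

lemma spread_mono (h : IsPullback p₁ p₂ q r) (X : C) : Mono (spread p₁ p₂ X) := by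
  have : IsIso (und (h.isoIsPullback _ _ (isPullback_pb q r)).hom) :=
    ⟨und (h.isoIsPullback _ _ (isPullback_pb q r)).inv, by rw [← und_comp]; simp,
      by rw [← und_comp]; simp⟩
  rw [spread_eq h]
  infer_instance

lemma exists_spread (h : IsPullback p₁ p₂ q r) {X T : C} (j : T ⟶ (X ⊗ N.X) ⊗ M.X)
    (hj : j ≫ (dup N X ≫ (X ⊗ N.X) ◁ und r) ▷ M.X =
      j ≫ dup M (X ⊗ N.X) ≫ ((X ⊗ N.X) ◁ und q) ▷ M.X) :
    ∃ k : T ⟶ X ⊗ P.X, k ≫ spread p₁ p₂ X = j := by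
  obtain ⟨k, hk⟩ := exists_pbInc q r (j ≫ (α_ X N.X M.X).hom) (by
    have e₁ : (α_ X N.X M.X).hom ≫ X ◁ (Δ[N.X] ≫ N.X ◁ und r) ▷ M.X =
        (dup N X ≫ (X ⊗ N.X) ◁ und r) ▷ M.X ≫ (α_ _ _ _).hom ▷ M.X ≫ (α_ _ _ _).hom := by
      rw [dup]; monoidal
    have e₂ : (α_ X N.X M.X).hom ≫ X ◁ (N.X ◁ (Δ[M.X] ≫ und q ▷ M.X) ≫ (α_ N.X B.X M.X).inv) =
        (dup M (X ⊗ N.X) ≫ ((X ⊗ N.X) ◁ und q) ▷ M.X) ≫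
          (α_ _ _ _).hom ▷ M.X ≫ (α_ _ _ _).hom := by
      rw [dup]; monoidal
    rw [Category.assoc, Category.assoc, e₁, e₂, reassoc_of% hj]
    simp only [Category.assoc])
  refine ⟨k ≫ X ◁ und (h.isoIsPullback _ _ (isPullback_pb q r)).inv, ?_⟩
  rw [Category.assoc, whiskerLeft_spread, IsPullback.isoIsPullback_inv_fst,
    IsPullback.isoIsPullback_inv_snd, spread_pb, reassoc_of% hk]
  simp

end ComodAux

namespace Comod

open MonoidalCategory ComonObj ComodAux

variable {C : Type u} [Category.{v} C] [MonoidalCategory C] [SymmetricCategory C]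
  {A B M N P K : CommComon C}

lemma spread_natural (p₁ : P ⟶ M) (p₂ : P ⟶ N) {X Y : C} (φ : X ⟶ Y) :
    φ ▷ P.X ≫ spread p₁ p₂ Y = spread p₁ p₂ X ≫ φ ▷ N.X ▷ M.X := by
  rw [spread, spread, dup_natural_assoc, Category.assoc, Category.assoc,
    whisker_exchange (φ ▷ N.X), ← comp_whiskerRight_assoc, ← comp_whiskerRight_assoc,
    whisker_exchange]

lemma spread_natural_assoc : type_of% (reassoc_of% @spread_natural) :=
  @(reassoc_of% @spread_natural)

lemma coactR_spread (p₁ : P ⟶ M) (p₂ : P ⟶ N) (s : N ⟶ A) (Z : Comod A) :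
    coactR (p₂ ≫ s) Z ≫ spread p₁ p₂ (Z.X ⊗ A.X) = spread p₁ p₂ Z.X ≫ coactR s Z ▷ M.X := by
  have h₁ : coactR (p₂ ≫ s) Z ≫ spread p₁ p₂ (Z.X ⊗ A.X) =
      dup P Z.X ≫ dup P (Z.X ⊗ P.X) ≫ ((Z.X ◁ und (p₂ ≫ s)) ▷ P.X ≫
        (Z.X ⊗ A.X) ◁ und p₂) ▷ P.X ≫ ((Z.X ⊗ A.X) ⊗ N.X) ◁ und p₁ := by
    rw [coactR, spread, Category.assoc, dup_natural_assoc, ← comp_whiskerRight_assoc]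
  have h₂ : spread p₁ p₂ Z.X ≫ coactR s Z ▷ M.X =
      dup P Z.X ≫ dup P Z.X ▷ P.X ≫ ((Z.X ◁ und (p₂ ≫ s)) ▷ P.X ≫
        (Z.X ⊗ A.X) ◁ und p₂) ▷ P.X ≫ ((Z.X ⊗ A.X) ⊗ N.X) ◁ und p₁ := by
    rw [spread, Category.assoc, Category.assoc, whisker_exchange, ← comp_whiskerRight_assoc,
      coactR, ← dup_hom_assoc, whisker_exchange, ← comp_whiskerRight_assoc (Z.X ◁ und p₂),
      ← whiskerLeft_comp, ← und_comp, comp_whiskerRight_assoc]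
  rw [h₁, h₂, dup_dup_assoc]

lemma coactR_spread_assoc : type_of% (reassoc_of% @coactR_spread) :=
  @(reassoc_of% @coactR_spread)

variable [HasCoreflexiveEqualizers C] [TensorPreservesCoreflexiveEqualizers C]

/-- The inclusion of an iterated cotensor product. -/
noncomputable def incPush (q : M ⟶ B) (r : N ⟶ B) (Y : Comod N) :
    (coextObj q ((push r).obj Y)).X ⟶ Y.X ⊗ M.X := inc q ((push r).obj Y)

instance (q : M ⟶ B) (r : N ⟶ B) (Y : Comod N) : Mono (incPush q r Y) :=
  inferInstanceAs (Mono (inc q ((push r).obj Y)))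

lemma incPush_condition (q : M ⟶ B) (r : N ⟶ B) (Y : Comod N) :
    incPush q r Y ≫ (Y.coact ≫ Y.X ◁ und r) ▷ M.X =
      incPush q r Y ≫ dup M Y.X ≫ (Y.X ◁ und q) ▷ M.X := inc_condition q ((push r).obj Y)

lemma incPush_condition_assoc : type_of% (reassoc_of% @incPush_condition) :=
  @(reassoc_of% @incPush_condition)

lemma isIso_of_isPullback {q : M ⟶ B} {r : N ⟶ B} {p₁ : P ⟶ M} {p₂ : P ⟶ N}
    (h : IsPullback p₁ p₂ q r) {s : N ⟶ A} {s' : P ⟶ A} (hs : s' = p₂ ≫ s) (Z : Comod A)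
    (a : (coextObj s' Z).X ⟶ (coextObj q ((push r).obj (coextObj s Z))).X)
    (ha : a ≫ incPush q r (coextObj s Z) ≫ inc s Z ▷ M.X = inc s' Z ≫ spread p₁ p₂ Z.X) :
    IsIso a := by
  subst hs
  obtain ⟨k, hk⟩ := exists_spread h (incPush q r (coextObj s Z) ≫ inc s Z ▷ M.X) (by
    simp only [Category.assoc]
    have e := incPush_condition q r (coextObj s Z)
    rw [← comp_whiskerRight, ← coact_inc_assoc, ← whisker_exchange, ← Category.assoc (_ : _ ⟶ _),
      comp_whiskerRight, reassoc_of% e, ← comp_whiskerRight, whisker_exchange, comp_whiskerRight,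
      dup_natural_assoc])
  have := spread_mono h
  obtain ⟨ψ, hψ⟩ := exists_inc (p₂ ≫ s) Z k (by
    rw [← cancel_mono (spread p₁ p₂ (Z.X ⊗ A.X))]
    simp only [Category.assoc]
    rw [spread_natural, coactR_spread, reassoc_of% hk, reassoc_of% hk, ← comp_whiskerRight,
      inc_condition, comp_whiskerRight])
  refine ⟨ψ, ?_, ?_⟩
  · rw [← cancel_mono (inc (p₂ ≫ s) Z), ← cancel_mono (spread p₁ p₂ Z.X)]
    simp only [Category.assoc, Category.id_comp]
    rw [reassoc_of% hψ, hk, ha]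
  · rw [← cancel_mono (incPush q r (coextObj s Z)), ← cancel_mono (inc s Z ▷ M.X)]
    simp only [Category.assoc, Category.id_comp]
    rw [ha, reassoc_of% hψ, hk]

lemma comp_incPush_inc {q : M ⟶ B} {r : N ⟶ B} {p₁ : P ⟶ M} {p₂ : P ⟶ N}
    {s : N ⟶ A} {s' : P ⟶ A} (Z : Comod A)
    (a : (coextObj s' Z).X ⟶ (coextObj q ((push r).obj (coextObj s Z))).X)
    (b : (coextObj s' Z).X ⟶ (coextObj s Z).X)
    (ha : IsOver p₁ (coextObj s' Z) (coextObj q ((push r).obj (coextObj s Z))) a)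
    (hab : a ≫ proj q ((push r).obj (coextObj s Z)) = b)
    (hb : IsOver p₂ (coextObj s' Z) (coextObj s Z) b) (hbp : b ≫ proj s Z = proj s' Z) :
    a ≫ incPush q r (coextObj s Z) ≫ inc s Z ▷ M.X = inc s' Z ≫ spread p₁ p₂ Z.X := by
  have h₁ : a ≫ incPush q r (coextObj s Z) =
      (coextObj s' Z).coact ≫ b ▷ P.X ≫ (coextObj s Z).X ◁ und p₁ := by
    subst hab; exact hom_inc ha
  have h₂ := hom_inc hb
  rw [hbp, reassoc_of% (coact_proj s' Z)] at h₂
  rw [reassoc_of% h₁, whisker_exchange, ← comp_whiskerRight_assoc, h₂, comp_whiskerRight_assoc,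
    coact_inc_assoc, spread]

end Comod

/-! ### Categories of comodules, indexed by spans -/

namespace ComodSpan

open SpanCat Comod Bicategory

variable {C : Type u} [Category.{v} C] [MonoidalCategory C] [SymmetricCategory C]
  [HasCoreflexiveEqualizers C] [TensorPreservesCoreflexiveEqualizers C]
  {A₁ A₂ A₃ A₄ A₅ A₆ : SpanCat (CommComon C)}

/-- Reindexing of comodules along a span: extend scalars along the right leg, then restrict them
along the left leg. -/
noncomputable def reindex (f : A₁ ⟶ A₂) : Comod A₂.as ⥤ Comod A₁.as :=
  coext (right f) ⋙ push (left f)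

/-- The projection from the cotensor product underlying `reindex`. -/
noncomputable def pr (f : A₁ ⟶ A₂) (Z : Comod A₂.as) : ((reindex f).obj Z).X ⟶ Z.X :=
  proj (right f) Z

/-- A map from a cotensor product, compatible with the coactions along a morphism from the apex. -/
def From (f : A₁ ⟶ A₂) (Z : Comod A₂.as) {D : CommComon C} (k : apex f ⟶ D) (W : Comod D)
    (a : ((reindex f).obj Z).X ⟶ W.X) : Prop :=
  IsOver k (coextObj (right f) Z) W a

/-- A map between cotensor products, compatible with the coactions along a morphism of apices. -/
def FromTo (f : A₁ ⟶ A₂) (Z : Comod A₂.as) (g : A₃ ⟶ A₄) (Y : Comod A₄.as) (k : apex f ⟶ apex g)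
    (a : ((reindex f).obj Z).X ⟶ ((reindex g).obj Y).X) : Prop :=
  IsOver k (coextObj (right f) Z) (coextObj (right g) Y) a

section

variable {f : A₁ ⟶ A₂} {Z : Comod A₂.as} {g : A₃ ⟶ A₄} {Y : Comod A₄.as}

lemma from_pr (f : A₁ ⟶ A₂) (Z : Comod A₂.as) : From f Z (right f) Z (pr f Z) :=
  isOver_proj _ _

lemma From.comp_hom {D : CommComon C} {k : apex f ⟶ D} {W W' : Comod D}
    {a : ((reindex f).obj Z).X ⟶ W.X} (h : From f Z k W a) (φ : W ⟶ W') :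
    From f Z k W' (a ≫ φ.hom) := IsOver.comp_hom h φ

lemma From.congr {D : CommComon C} {k k' : apex f ⟶ D} {W : Comod D}
    {a : ((reindex f).obj Z).X ⟶ W.X} (h : From f Z k W a) (e : k = k') : From f Z k' W a := by
  subst e; exact h

lemma FromTo.congr {k k' : apex f ⟶ apex g} {a b : ((reindex f).obj Z).X ⟶ ((reindex g).obj Y).X}
    (h : FromTo f Z g Y k a) (e : k = k') (e' : a = b) : FromTo f Z g Y k' b := by
  subst e e'; exact h

lemma FromTo.id : FromTo f Z f Z (𝟙 _) (𝟙 _) := isOver_hom (𝟙 (coextObj (right f) Z))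

lemma FromTo.comp {h : A₅ ⟶ A₆} {X : Comod A₆.as} {k : apex f ⟶ apex g} {l : apex g ⟶ apex h}
    {a : ((reindex f).obj Z).X ⟶ ((reindex g).obj Y).X}
    {b : ((reindex g).obj Y).X ⟶ ((reindex h).obj X).X}
    (ha : FromTo f Z g Y k a) (hb : FromTo g Y h X l b) : FromTo f Z h X (k ≫ l) (a ≫ b) :=
  IsOver.comp ha hb

lemma FromTo.comp_from {D : CommComon C} {W : Comod D} {k : apex f ⟶ apex g} {l : apex g ⟶ D}
    {a : ((reindex f).obj Z).X ⟶ ((reindex g).obj Y).X} {b : ((reindex g).obj Y).X ⟶ W.X}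
    (ha : FromTo f Z g Y k a) (hb : From g Y l W b) : From f Z (k ≫ l) W (a ≫ b) :=
  IsOver.comp ha hb

lemma FromTo.comp_pr {k : apex f ⟶ apex g} {a : ((reindex f).obj Z).X ⟶ ((reindex g).obj Y).X}
    (ha : FromTo f Z g Y k a) : From f Z (k ≫ right g) Y (a ≫ pr g Y) :=
  ha.comp_from (from_pr g Y)

lemma FromTo.from {k : apex f ⟶ apex g} {a : ((reindex f).obj Z).X ⟶ ((reindex g).obj Y).X}
    (ha : FromTo f Z g Y k a) : From f Z (k ≫ left g) ((reindex g).obj Y) a :=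
  IsOver.to_push ha

lemma ext {k : apex f ⟶ apex g} {a b : ((reindex f).obj Z).X ⟶ ((reindex g).obj Y).X}
    (ha : FromTo f Z g Y k a) (hb : FromTo f Z g Y k b) (h : a ≫ pr g Y = b ≫ pr g Y) : a = b :=
  ext_proj (X := coextObj (right f) Z) ha hb h

/-- The universal property of the cotensor product. -/
noncomputable def lift {k : apex f ⟶ apex g} {φ : ((reindex f).obj Z).X ⟶ Y.X}
    (h : From f Z (k ≫ right g) Y φ) : ((reindex f).obj Z).X ⟶ ((reindex g).obj Y).X :=
  fill (X := coextObj (right f) Z) h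

@[simp] lemma lift_pr {k : apex f ⟶ apex g} {φ : ((reindex f).obj Z).X ⟶ Y.X}
    (h : From f Z (k ≫ right g) Y φ) : lift h ≫ pr g Y = φ :=
  fill_proj (X := coextObj (right f) Z) h

@[simp] lemma lift_pr_assoc : type_of% (reassoc_of% @lift_pr) :=
  @(reassoc_of% @lift_pr)

lemma fromTo_lift {k : apex f ⟶ apex g} {φ : ((reindex f).obj Z).X ⟶ Y.X}
    (h : From f Z (k ≫ right g) Y φ) : FromTo f Z g Y k (lift h) :=
  isOver_fill (X := coextObj (right f) Z) h

end

section

variable {f : A₁ ⟶ A₂} {Z : Comod A₂.as}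

lemma From.hom_comm {W : Comod A₁.as} {a : ((reindex f).obj Z).X ⟶ W.X}
    (h : From f Z (left f) W a) : IsOver (𝟙 _) ((reindex f).obj Z) W a :=
  IsOver.from_push (h.congr (Category.comp_id _).symm)

/-- A compatible map from a cotensor product as a morphism of comodules. -/
noncomputable def From.toHom {W : Comod A₁.as} {a : ((reindex f).obj Z).X ⟶ W.X} (h : From f Z (left f) W a) :
    (reindex f).obj Z ⟶ W := h.hom_comm.toHom

@[simp] lemma From.toHom_hom {W : Comod A₁.as} {a : ((reindex f).obj Z).X ⟶ W.X}
    (h : From f Z (left f) W a) : h.toHom.hom = a := (rfl)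

lemma fromTo_map (f : A₁ ⟶ A₂) {Y Z : Comod A₂.as} (a : Y ⟶ Z) :
    FromTo f Y f Z (𝟙 _) ((reindex f).map a).hom := isOver_hom ((coext (right f)).map a)

@[simp] lemma map_pr (f : A₁ ⟶ A₂) {Y Z : Comod A₂.as} (a : Y ⟶ Z) :
    ((reindex f).map a).hom ≫ pr f Z = pr f Y ≫ a.hom := coext_map_proj _ _

@[simp] lemma map_pr_assoc : type_of% (reassoc_of% @map_pr) :=
  @(reassoc_of% @map_pr)

end

lemma from_reindex₂ {f g : A₁ ⟶ A₂} (m : f ⟶ g) (Z : Comod A₂.as) :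
    From f Z (top m ≫ right g) Z (pr f Z) := (from_pr f Z).congr (by simp)

/-- Reindexing on morphisms of spans. -/
noncomputable def reindex₂ {f g : A₁ ⟶ A₂} (m : f ⟶ g) : reindex f ⟶ reindex g where
  app Z := From.toHom (a := lift (from_reindex₂ m Z))
    ((fromTo_lift (from_reindex₂ m Z)).from.congr (by simp))
  naturality Y Z a := by
    ext
    refine ext ((fromTo_map f a).comp (fromTo_lift (from_reindex₂ m Z)))
      (((fromTo_lift (from_reindex₂ m Y)).comp (fromTo_map g a)).congr (by simp) rfl) ?_
    simp

lemma fromTo_reindex₂ {f g : A₁ ⟶ A₂} (m : f ⟶ g) (Z : Comod A₂.as) :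
    FromTo f Z g Z (top m) ((reindex₂ m).app Z).hom := fromTo_lift (from_reindex₂ m Z)

@[simp] lemma reindex₂_pr {f g : A₁ ⟶ A₂} (m : f ⟶ g) (Z : Comod A₂.as) :
    ((reindex₂ m).app Z).hom ≫ pr g Z = pr f Z :=
  lift_pr (from_reindex₂ m Z)

@[simp] lemma reindex₂_pr_assoc : type_of% (reassoc_of% @reindex₂_pr) :=
  @(reassoc_of% @reindex₂_pr)

/-- A morphism of comodules whose underlying morphism is invertible is an isomorphism. -/
noncomputable def isoOfIsIso {A : CommComon C} {X Y : Comod A} (f : X ⟶ Y) (h : IsIso f.hom) :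
    X ≅ Y where
  hom := f
  inv := ⟨inv f.hom, by
    rw [IsIso.inv_comp_eq, f.comm_assoc, ← MonoidalCategory.comp_whiskerRight,
      IsIso.hom_inv_id, MonoidalCategory.id_whiskerRight, Category.comp_id]⟩
  hom_inv_id := by ext; exact IsIso.hom_inv_id f.hom
  inv_hom_id := by ext; exact IsIso.inv_hom_id f.hom

@[simp] lemma isoOfIsIso_hom {A : CommComon C} {X Y : Comod A} (f : X ⟶ Y) (h : IsIso f.hom) :
    (isoOfIsIso f h).hom = f := (rfl)

lemma isOver_unit (A : SpanCat (CommComon C)) (Z : Comod A.as) :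
    IsOver (idInv A ≫ right (𝟙 A)) Z Z (𝟙 Z.X) :=
  (isOver_hom (𝟙 Z)).congr (by simp) rfl

lemma isIso_unit (A : SpanCat (CommComon C)) (Z : Comod A.as) : IsIso (pr (𝟙 A) Z) := by
  refine ⟨fill (isOver_unit A Z), ?_, fill_proj (isOver_unit A Z)⟩
  refine ext (f := 𝟙 A) (g := 𝟙 A) (((isOver_proj _ _).comp (isOver_fill (isOver_unit A Z))).congr
    (by simp) rfl) FromTo.id ?_
  refine (Category.assoc _ _ _).trans ?_
  refine (congrArg _ (fill_proj (isOver_unit A Z))).trans ?_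
  simp

/-- Reindexing along the identity span. -/
noncomputable def unit (A : SpanCat (CommComon C)) : reindex (𝟙 A) ≅ 𝟭 (Comod A.as) :=
  NatIso.ofComponents (fun Z => isoOfIsIso (Y := Z) (from_pr (𝟙 A) Z).toHom (isIso_unit A Z))
    (fun a => by ext; exact map_pr _ _)

@[simp] lemma unit_hom (A : SpanCat (CommComon C)) (Z : Comod A.as) :
    ((unit A).hom.app Z).hom = pr (𝟙 A) Z := (rfl)

section

variable (f : A₁ ⟶ A₂) (g : A₂ ⟶ A₃) (Z : Comod A₃.as)

lemma from_mult₂ : From (f ≫ g) Z (p₂ f g ≫ right g) Z (pr (f ≫ g) Z) :=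
  (from_pr (f ≫ g) Z).congr (by simp)

lemma from_mult₁ :
    From (f ≫ g) Z (p₁ f g ≫ right f) ((reindex g).obj Z) (lift (from_mult₂ f g Z)) :=
  (fromTo_lift (from_mult₂ f g Z)).from.congr (SpanCat.condition f g).symm

/-- The comparison between the two reindexings along a composite. -/
noncomputable def multHom : (reindex (f ≫ g)).obj Z ⟶ (reindex f).obj ((reindex g).obj Z) :=
  From.toHom (a := lift (from_mult₁ f g Z)) ((fromTo_lift (from_mult₁ f g Z)).from.congr (by simp))

lemma fromTo_mult :
    FromTo (f ≫ g) Z f ((reindex g).obj Z) (p₁ f g) (multHom f g Z).hom :=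
  fromTo_lift (from_mult₁ f g Z)

lemma mult_pr : (multHom f g Z).hom ≫ pr f ((reindex g).obj Z) = lift (from_mult₂ f g Z) :=
  lift_pr (from_mult₁ f g Z)

lemma fromTo_mult_pr :
    FromTo (f ≫ g) Z g Z (p₂ f g) ((multHom f g Z).hom ≫ pr f ((reindex g).obj Z)) := by
  rw [mult_pr]; exact fromTo_lift (from_mult₂ f g Z)

@[simp] lemma mult_pr_pr :
    (multHom f g Z).hom ≫ pr f ((reindex g).obj Z) ≫ pr g Z = pr (f ≫ g) Z := by
  rw [← Category.assoc, mult_pr, lift_pr]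

@[simp] lemma mult_pr_pr_assoc : type_of% (reassoc_of% @mult_pr_pr) :=
  @(reassoc_of% @mult_pr_pr)

lemma isIso_mult : IsIso (multHom f g Z).hom :=
  isIso_of_isPullback (SpanCat.isPullback f g) (comp_right f g).symm Z _
    (comp_incPush_inc Z _ _ (fromTo_mult f g Z) (mult_pr f g Z)
      (fromTo_lift (from_mult₂ f g Z)) (lift_pr (from_mult₂ f g Z)))

end

/-- Two maps to an iterated cotensor product agree if their projections do. -/
lemma ext₂ {f : A₁ ⟶ A₂} {g : A₂ ⟶ A₃} {Z : Comod A₃.as} {A₄ A₅ : SpanCat (CommComon C)} {h : A₄ ⟶ A₅} {Y : Comod A₅.as}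
    {k : apex h ⟶ apex f} {l : apex h ⟶ apex g}
    {a b : ((reindex h).obj Y).X ⟶ ((reindex f).obj ((reindex g).obj Z)).X}
    (ha : FromTo h Y f ((reindex g).obj Z) k a) (hb : FromTo h Y f ((reindex g).obj Z) k b)
    (ha' : FromTo h Y g Z l (a ≫ pr f ((reindex g).obj Z)))
    (hb' : FromTo h Y g Z l (b ≫ pr f ((reindex g).obj Z)))
    (e : a ≫ pr f ((reindex g).obj Z) ≫ pr g Z = b ≫ pr f ((reindex g).obj Z) ≫ pr g Z) :
    a = b :=
  ext ha hb (ext ha' hb' (by simpa using e))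

/-- Reindexing along a composite span. -/
noncomputable def mult (f : A₁ ⟶ A₂) (g : A₂ ⟶ A₃) :
    reindex (f ≫ g) ≅ reindex g ⋙ reindex f :=
  NatIso.ofComponents (fun Z => isoOfIsIso (multHom f g Z) (isIso_mult f g Z))
    (fun {Y Z} a => by
      ext
      refine ext₂ (f := f) (g := g) (k := p₁ f g) (l := p₂ f g)
        (((fromTo_map _ a).comp (fromTo_mult f g Z)).congr (by simp) rfl)
        (((fromTo_mult f g Y).comp (fromTo_map f ((reindex g).map a))).congr (by simp) rfl)
        (((fromTo_map _ a).comp (fromTo_mult_pr f g Z)).congr (by simp) (by simp))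
        (((fromTo_mult_pr f g Y).comp (fromTo_map g a)).congr (by simp) (by simp)) (by simp))

@[simp] lemma mult_hom (f : A₁ ⟶ A₂) (g : A₂ ⟶ A₃) (Z : Comod A₃.as) :
    (mult f g).hom.app Z = multHom f g Z := (rfl)

lemma reindex₂_id (f : A₁ ⟶ A₂) (Z : Comod A₂.as) : (reindex₂ (𝟙 f)).app Z = 𝟙 _ := by
  ext
  exact ext (fromTo_reindex₂ _ _) (FromTo.id.congr (by simp) rfl) (by simp)

lemma reindex₂_comp {f g h : A₁ ⟶ A₂} (m : f ⟶ g) (n : g ⟶ h) (Z : Comod A₂.as) :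
    (reindex₂ (m ≫ n)).app Z = (reindex₂ m).app Z ≫ (reindex₂ n).app Z := by
  ext
  exact ext (fromTo_reindex₂ _ _)
    (((fromTo_reindex₂ m Z).comp (fromTo_reindex₂ n Z)).congr (by simp) rfl) (by simp)

lemma whiskerRight {f g : A₁ ⟶ A₂} (m : f ⟶ g) (h : A₂ ⟶ A₃) (Z : Comod A₃.as) :
    (reindex₂ (whiskerR m h)).app Z ≫ (mult g h).hom.app Z =
      (mult f h).hom.app Z ≫ (reindex₂ m).app ((reindex h).obj Z) := by
  ext
  exact ext₂ (f := g) (g := h) (k := p₁ f h ≫ top m) (l := p₂ f h)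
    (((fromTo_reindex₂ (whiskerR m h) Z).comp (fromTo_mult g h Z)).congr (by simp) rfl)
    ((fromTo_mult f h Z).comp (fromTo_reindex₂ m ((reindex h).obj Z)))
    (((fromTo_reindex₂ (whiskerR m h) Z).comp (fromTo_mult_pr g h Z)).congr (by simp) (by simp))
    ((fromTo_mult_pr f h Z).congr rfl (by simp)) (by simp)

lemma whiskerLeft (f : A₁ ⟶ A₂) {g h : A₂ ⟶ A₃} (m : g ⟶ h) (Z : Comod A₃.as) :
    (reindex₂ (whiskerL f m)).app Z ≫ (mult f h).hom.app Z =
      (mult f g).hom.app Z ≫ (reindex f).map ((reindex₂ m).app Z) := by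
  ext
  exact ext₂ (f := f) (g := h) (k := p₁ f g) (l := p₂ f g ≫ top m)
    (((fromTo_reindex₂ (whiskerL f m) Z).comp (fromTo_mult f h Z)).congr (by simp) rfl)
    (((fromTo_mult f g Z).comp (fromTo_map f ((reindex₂ m).app Z))).congr (by simp) rfl)
    (((fromTo_reindex₂ (whiskerL f m) Z).comp (fromTo_mult_pr f h Z)).congr (by simp) (by simp))
    (((fromTo_mult_pr f g Z).comp (fromTo_reindex₂ m Z)).congr (by simp) (by simp)) (by simp)

lemma assoc (f : A₁ ⟶ A₂) (g : A₂ ⟶ A₃) (h : A₃ ⟶ A₄) (Z : Comod A₄.as) :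
    (reindex₂ (SpanCat.assoc f g h).hom).app Z ≫ (mult f (g ≫ h)).hom.app Z ≫
      (reindex f).map ((mult g h).hom.app Z) =
    (mult (f ≫ g) h).hom.app Z ≫ (mult f g).hom.app ((reindex h).obj Z) := by
  ext
  have h₁ := fromTo_reindex₂ (SpanCat.assoc f g h).hom Z
  have h₂ := h₁.comp (fromTo_mult_pr f (g ≫ h) Z)
  have h₃ := fromTo_mult (f ≫ g) h Z
  refine ext (f := (f ≫ g) ≫ h) (g := f) (k := p₁ (f ≫ g) h ≫ p₁ f g)
    ((h₁.comp ((fromTo_mult f (g ≫ h) Z).comp (fromTo_map f (multHom g h Z)))).congr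
      (by simp) (by simp))
    ((h₃.comp (fromTo_mult f g ((reindex h).obj Z))).congr rfl (by simp)) ?_
  refine ext₂ (f := g) (g := h) (k := p₁ (f ≫ g) h ≫ p₂ f g) (l := p₂ (f ≫ g) h)
    ((h₂.comp (fromTo_mult g h Z)).congr (by simp) (by simp))
    ((h₃.comp (fromTo_mult_pr f g ((reindex h).obj Z))).congr rfl (by simp))
    ((h₂.comp (fromTo_mult_pr g h Z)).congr (by simp) (by simp))
    ((fromTo_mult_pr (f ≫ g) h Z).congr rfl (by simp)) (by simp)

lemma leftUnitor (f : A₁ ⟶ A₂) (Z : Comod A₂.as) :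
    (reindex₂ (leftU f).hom).app Z =
      (mult (𝟙 A₁) f).hom.app Z ≫ (unit A₁).hom.app ((reindex f).obj Z) := by
  ext
  exact ext (fromTo_reindex₂ _ _) ((fromTo_mult_pr (𝟙 A₁) f Z).congr (by simp) (by simp)) (by simp)

lemma rightUnitor (f : A₁ ⟶ A₂) (Z : Comod A₂.as) :
    (reindex₂ (rightU f).hom).app Z =
      (mult f (𝟙 A₂)).hom.app Z ≫ (reindex f).map ((unit A₂).hom.app Z) := by
  ext
  exact ext (fromTo_reindex₂ _ _)
    (((fromTo_mult f (𝟙 A₂) Z).comp (fromTo_map f ((unit A₂).hom.app Z))).congr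
      (by simp) (by simp)) (by simp)

/-- The `Span (CommComon C)`-indexed category of comodules. -/
noncomputable def core (C : Type u) [Category.{v} C] [MonoidalCategory C] [SymmetricCategory C]
    [HasCoreflexiveEqualizers C] [TensorPreservesCoreflexiveEqualizers C] :
    IndexedCatCore (SpanCat (CommComon C)) where
  E A := Comod A.as
  pull f := reindex f
  pull₂ m := reindex₂ m
  unit A := unit A
  mult f g := mult f g
  pull₂_id f Z := reindex₂_id f Z
  pull₂_comp m n Z := reindex₂_comp m n Z
  whiskerRight m h Z := whiskerRight m h Z
  whiskerLeft f _ _ m Z := whiskerLeft f m Z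
  assoc f g h Z := assoc f g h Z
  leftUnitor f Z := leftUnitor f Z
  rightUnitor f Z := rightUnitor f Z

end ComodSpan

/-! ### Dependent monoidal lenses -/

section DLens

variable (C : Type u) [Category.{v} C] [MonoidalCategory C] [SymmetricCategory C]
  [HasCoreflexiveEqualizers C] [TensorPreservesCoreflexiveEqualizers C]

/-- The indexed category of commutative coalgebras over commutative comonoids, that is, of slices
of the category of commutative comonoids. It is indexed by spans of commutative comonoids. -/
noncomputable def CCoalgIndexed : Pseudofunctor (SpanCat (CommComon C))ᵒᵖ Cat.{v, max u v} :=
  (OverSpan.core (CommComon C)).toIndexedCat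

/-- The indexed category of comodules over commutative comonoids. It is indexed by spans of
commutative comonoids. -/
noncomputable def ComodIndexed : Pseudofunctor (SpanCat (CommComon C))ᵒᵖ Cat.{v, max u v} :=
  (ComodSpan.core C).toIndexedCat

/-- The category of dependent monoidal lenses. -/
abbrev DLens : Type _ := Optic (CCoalgIndexed C) (ComodIndexed C)

end DLens

/-! A forward part from `X` to `M ⊗_B Y` over `A` consists of a morphism `φ` from `X` to `Y` in the
category of commutative comonoids and a morphism from `X` to `M` compatible with the legs. The
second datum is a morphism to `M` from the span with apex `X` whose legs are the structure map to
`A` and the composite of `φ` with the structure map of `Y`; call it the graph of `φ`. By the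
co-Yoneda lemma the coend therefore collapses: a lens is the same as a `φ` together with a single
backward part over its graph. `exists_graphLens` shows that every class has this normal form, and
`normal_graphLens` that the normal form is unique.

Restriction of scalars along the structure map of `X` is left adjoint to extension
(`Comod.pushHom_bijective`). So the backward part amounts to a map of `X`-comodules, from the
extension of `Y'` along `X ⟶ Y ⟶ B` to the extension of `X'` along `X ⟶ A`. The base comonoids now
enter only through these extended comodules.

This dictates the coproduct of a finite family `(X i, X' i)^(A i)`. Let `S` be the coproduct of the
comonoids `X i`; it is computed in `C`. By essential surjectivity of the functor in the hypothesis
there is an `S`-comodule `N` whose extension along each inclusion is the extension of `X' i` to `X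
i`. The coproduct is `(S, N)^S`; its base is `S` and not the coproduct of the `A i`. A lens out of
it has as forward part a map out of `S`, which is a family of maps out of the `X i`, and as backward
part a map of `S`-comodules to `N`, which by full faithfulness is a family of maps between the
extensions to the `X i`.

To match these families with the backward parts of the composites with the inclusions, the composite
of two graphs has to be the graph of the composite. This holds because the structure map of `S` over
itself is an identity (`isIso_graphComp`). The matching is `restrictBwd_bijective`, and
`existsUnique_desc` deduces the universal property from it. -/

namespace ComodAux

/-! ### Coproducts of commutative comonoids, computed in the underlying category. -/

open MonoidalCategory ComonObj

variable {C : Type u} [Category.{v} C] [MonoidalCategory C] [SymmetricCategory C]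
  {ι : Type w} (A : ι → CommComon C) [HasColimit (Discrete.functor fun i => (A i).X)]

/-- The underlying object of a coproduct of commutative comonoids. -/
noncomputable def sigmaObj : C := ∐ fun i => (A i).X

/-- The inclusion of a summand in the underlying object of a coproduct. -/
noncomputable def sigmaInc (i : ι) : (A i).X ⟶ sigmaObj A := Sigma.ι (fun i => (A i).X) i

variable {A}

lemma sigmaObj_ext {T : C} {f g : sigmaObj A ⟶ T}
    (h : ∀ i, sigmaInc A i ≫ f = sigmaInc A i ≫ g) : f = g := Sigma.hom_ext _ _ h

/-- Maps out of the underlying object of a coproduct. -/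
noncomputable def sigmaDesc {T : C} (f : ∀ i, (A i).X ⟶ T) : sigmaObj A ⟶ T := Sigma.desc f

@[simp] lemma sigmaInc_desc {T : C} (f : ∀ i, (A i).X ⟶ T) (i : ι) :
    sigmaInc A i ≫ sigmaDesc f = f i := Sigma.ι_desc _ _

@[simp] lemma sigmaInc_desc_assoc : type_of% (reassoc_of% @sigmaInc_desc) :=
  @(reassoc_of% @sigmaInc_desc)

variable (A)

/-- The comonoid structure on a coproduct of commutative comonoids. -/
noncomputable instance : ComonObj (sigmaObj A) where
  -- Counit and comultiplication are maps out of the coproduct, so they are defined and their laws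
  -- are checked one summand at a time. The tensor product does not have to preserve coproducts.
  counit := sigmaDesc fun i => ε[(A i).X]
  comul := sigmaDesc fun i => Δ[(A i).X] ≫ (sigmaInc A i ⊗ₘ sigmaInc A i)
  counit_comul := by
    refine sigmaObj_ext fun i => ?_
    rw [sigmaInc_desc_assoc, Category.assoc, tensorHom_comp_whiskerRight, sigmaInc_desc,
      MonoidalCategory.tensorHom_def, counit_comul_assoc, leftUnitor_inv_naturality]
  comul_counit := by
    refine sigmaObj_ext fun i => ?_
    rw [sigmaInc_desc_assoc, Category.assoc, tensorHom_comp_whiskerLeft, sigmaInc_desc,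
      MonoidalCategory.tensorHom_def', comul_counit_assoc, rightUnitor_inv_naturality]
  comul_assoc := by
    refine sigmaObj_ext fun i => ?_
    rw [sigmaInc_desc_assoc, Category.assoc, tensorHom_comp_whiskerLeft, sigmaInc_desc,
      sigmaInc_desc_assoc, Category.assoc, tensorHom_comp_whiskerRight_assoc, sigmaInc_desc,
      ← whiskerLeft_comp_tensorHom, ← whiskerRight_comp_tensorHom_assoc, associator_naturality,
      comul_assoc_assoc]

instance : IsCommComonObj (sigmaObj A) where
  comul_comm := by
    refine sigmaObj_ext fun i => ?_
    change _ ≫ sigmaDesc _ ≫ _ = _ ≫ sigmaDesc _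
    rw [sigmaInc_desc_assoc, sigmaInc_desc, Category.assoc,
      BraidedCategory.braiding_naturality, IsCommComonObj.comul_comm_assoc]

/-- A family of morphisms of comonoids induces a morphism of comonoids on the coproduct. -/
lemma sigmaDesc_isComonHom {T : CommComon C} (f : ∀ i, A i ⟶ T) :
    IsComonHom (sigmaDesc (A := A) fun i => und (f i)) where
  hom_counit := by
    refine sigmaObj_ext (A := A) fun i => ?_
    rw [sigmaInc_desc_assoc, und_counit]
    change _ = sigmaInc A i ≫ sigmaDesc _
    rw [sigmaInc_desc]
  hom_comul := by
    have h i := und_isComonHom (f i)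
    refine sigmaObj_ext (A := A) fun i => ?_
    change _ = _ ≫ sigmaDesc _ ≫ _
    rw [sigmaInc_desc_assoc, sigmaInc_desc_assoc, Category.assoc,
      MonoidalCategory.tensorHom_comp_tensorHom, sigmaInc_desc, IsComonHom.hom_comul]

/-- The coproduct of commutative comonoids. -/
noncomputable def sigmaCofan : Cofan A :=
  Cofan.mk (⟨sigmaObj A⟩ : CommComon C) fun i =>
    -- Compatibility of an inclusion with counit and comultiplication is exactly how these were
    -- defined on the summand.
    comHom (sigmaInc A i) ⟨sigmaInc_desc _ _, sigmaInc_desc _ _⟩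

/-- The universal property of the coproduct of commutative comonoids. -/
noncomputable def isColimitSigmaCofan : IsColimit (sigmaCofan A) :=
  Cofan.IsColimit.mk _ (fun s => comHom _ (sigmaDesc_isComonHom A s.inj))
    (fun _ _ => und_ext (sigmaInc_desc _ _))
    (fun s _ h => und_ext (sigmaObj_ext fun i =>
      (congrArg und (h i)).trans (sigmaInc_desc (fun i => und (s.inj i)) i).symm))

end ComodAux
-- Dependent lenses in terms of slices and comodules.
namespace DLens

open SpanCat Optic IndexedCat ComodAux

variable {C : Type u} [Category.{v} C] [MonoidalCategory C] [SymmetricCategory C]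
  [HasCoreflexiveEqualizers C] [TensorPreservesCoreflexiveEqualizers C]

/-- The commutative coalgebra `X` of `(X, X')^A`. -/
def coalg (X : DLens C) : Over X.base.as := X.fwd

/-- The comodule `X'` of `(X, X')^A`. -/
def comod (X : DLens C) : Comod X.base.as := X.bwd

/-- The object `(X, X')^A`. -/
noncomputable def of {A : CommComon C} (X : Over A) (X' : Comod A) : DLens C := ⟨⟨A⟩, X, X'⟩

/-- The dependent lens `⟨l | r⟩` with representative `f`. -/
noncomputable def lens {X Y : DLens C} (f : X.base ⟶ Y.base) (l : coalg X ⟶ (OverSpan.reindex f).obj (coalg Y))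
    (r : (ComodSpan.reindex f).obj (comod Y) ⟶ comod X) : X ⟶ Y := cls f l r

lemma lens_ind {X Y : DLens C} {p : (X ⟶ Y) → Prop} (h : ∀ f l r, p (lens f l r)) (a : X ⟶ Y) :
    p a := Optic.ind h a

/-- One instance of the coend relation. The components are typed in `Over` and `Comod` instead of
the fibres of the two pseudofunctors, so that the projection lemmas for `OverSpan` and `ComodSpan`
apply to them. -/
lemma lens_eq {X Y : DLens C} {f g : X.base ⟶ Y.base} (m : f ⟶ g)
    {l : coalg X ⟶ (OverSpan.reindex f).obj (coalg Y)}
    {l' : coalg X ⟶ (OverSpan.reindex g).obj (coalg Y)}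
    {r : (ComodSpan.reindex f).obj (comod Y) ⟶ comod X}
    {r' : (ComodSpan.reindex g).obj (comod Y) ⟶ comod X}
    (hl : l ≫ (OverSpan.reindex₂ m).app (coalg Y) = l')
    (hr : r = (ComodSpan.reindex₂ m).app (comod Y) ≫ r') : lens f l r = lens g l' r' :=
  cls_eq (L := CCoalgIndexed C) (R := ComodIndexed C) m hl hr

lemma lens_comp {X Y Z : DLens C} (f : X.base ⟶ Y.base) (g : Y.base ⟶ Z.base)
    (l : coalg X ⟶ (OverSpan.reindex f).obj (coalg Y))
    (l' : coalg Y ⟶ (OverSpan.reindex g).obj (coalg Z))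
    (r : (ComodSpan.reindex f).obj (comod Y) ⟶ comod X)
    (r' : (ComodSpan.reindex g).obj (comod Z) ⟶ comod Y) :
    lens f l r ≫ lens g l' r' = lens (f ≫ g)
      (l ≫ (OverSpan.reindex f).map l' ≫ (OverSpan.mult f g).inv.app (coalg Z))
      (ComodSpan.multHom f g (comod Z) ≫ (ComodSpan.reindex f).map r' ≫ r) := rfl

/-! ### Graphs of comonoid morphisms and the normal form of a lens. -/

section
variable {X Y : DLens C}

/-- The span `A ⟵ X ⟶ B` given by a morphism `X ⟶ Y`. -/
noncomputable def graph (φ : (coalg X).left ⟶ (coalg Y).left) : X.base ⟶ Y.base :=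
  mkSpan (coalg X).hom (φ ≫ (coalg Y).hom)

/-- The identity, as a map to the apex of a graph. -/
noncomputable def toGraph (φ : (coalg X).left ⟶ (coalg Y).left) :
    (coalg X).left ⟶ apex (graph φ) := 𝟙 _

/-- The identity, as a map from the apex of a graph. -/
noncomputable def ofGraph (φ : (coalg X).left ⟶ (coalg Y).left) :
    apex (graph φ) ⟶ (coalg X).left := 𝟙 (coalg X).left

-- The apex of a graph is `(coalg X).left` only after unfolding. The two named identities mark each
-- passage between these types, which keeps equations of composites accessible to `simp`.
@[simp] lemma toGraph_ofGraph (φ : (coalg X).left ⟶ (coalg Y).left) :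
    toGraph φ ≫ ofGraph φ = 𝟙 _ := Category.id_comp _

@[simp] lemma toGraph_ofGraph_assoc : type_of% (reassoc_of% @toGraph_ofGraph) :=
  @(reassoc_of% @toGraph_ofGraph)

@[simp] lemma ofGraph_toGraph (φ : (coalg X).left ⟶ (coalg Y).left) :
    ofGraph φ ≫ toGraph φ = 𝟙 _ := Category.id_comp _

lemma left_graph (φ : (coalg X).left ⟶ (coalg Y).left) :
    left (graph φ) = ofGraph φ ≫ (coalg X).hom := (Category.id_comp _).symm

lemma right_graph (φ : (coalg X).left ⟶ (coalg Y).left) :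
    right (graph φ) = ofGraph φ ≫ φ ≫ (coalg Y).hom := (Category.id_comp _).symm

/-- The tautological forward part with representative `graph φ`. -/
noncomputable def graphFwd (φ : (coalg X).left ⟶ (coalg Y).left) :
    coalg X ⟶ (OverSpan.reindex (graph φ)).obj (coalg Y) :=
  Over.homMk (OverSpan.lift φ (toGraph φ) (by simp [right_graph])) (by simp [left_graph])

@[simp] lemma graphFwd_pr (φ : (coalg X).left ⟶ (coalg Y).left) :
    (graphFwd φ).left ≫ OverSpan.pr (graph φ) (coalg Y) = φ := OverSpan.lift_pr _ _ _

@[simp] lemma graphFwd_ap (φ : (coalg X).left ⟶ (coalg Y).left) :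
    (graphFwd φ).left ≫ OverSpan.ap (graph φ) (coalg Y) = toGraph φ := OverSpan.lift_ap _ _ _

/-- The lens given by a morphism `X ⟶ Y` and a backward part over its graph. -/
noncomputable def graphLens (φ : (coalg X).left ⟶ (coalg Y).left)
    (r : (ComodSpan.reindex (graph φ)).obj (comod Y) ⟶ comod X) : X ⟶ Y :=
  lens (graph φ) (graphFwd φ) r

/-- The morphism of spans from a graph given by a forward part. -/
noncomputable def fromGraph {φ : (coalg X).left ⟶ (coalg Y).left} {f : X.base ⟶ Y.base}
    (l : coalg X ⟶ (OverSpan.reindex f).obj (coalg Y))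
    (h : l.left ≫ OverSpan.pr f (coalg Y) = φ) : graph φ ⟶ f :=
  -- The target of `l` is a pullback, so `l` has a component in `coalg Y`, which is `φ`, and a
  -- component in the apex of `f`, which is the map wanted here. The left legs agree because `l` is
  -- a morphism of the slice, the right legs because the pullback square commutes.
  mkHom (ofGraph φ ≫ l.left ≫ OverSpan.ap f (coalg Y))
    (by
      have := Over.w l
      rw [OverSpan.reindex_hom] at this
      rw [left_graph, Category.assoc, Category.assoc, this])
    (by rw [Category.assoc, Category.assoc, ← OverSpan.condition, reassoc_of% h, right_graph])

@[simp] lemma top_fromGraph {φ : (coalg X).left ⟶ (coalg Y).left} {f : X.base ⟶ Y.base}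
    (l : coalg X ⟶ (OverSpan.reindex f).obj (coalg Y))
    (h : l.left ≫ OverSpan.pr f (coalg Y) = φ) :
    top (fromGraph l h) = ofGraph φ ≫ l.left ≫ OverSpan.ap f (coalg Y) := rfl

/-- The co-Yoneda argument: `l` is the image of the tautological `graphFwd φ` under the span
morphism `fromGraph l h`, and the coend relation moves that span morphism to the backward part. -/
lemma lens_eq_graphLens {φ : (coalg X).left ⟶ (coalg Y).left} (f : X.base ⟶ Y.base)
    (l : coalg X ⟶ (OverSpan.reindex f).obj (coalg Y))
    (r : (ComodSpan.reindex f).obj (comod Y) ⟶ comod X)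
    (h : l.left ≫ OverSpan.pr f (coalg Y) = φ) :
    lens f l r = graphLens φ ((ComodSpan.reindex₂ (fromGraph l h)).app (comod Y) ≫ r) := by
  refine (lens_eq (fromGraph l h) ?_ rfl).symm
  refine Over.OverMorphism.ext (OverSpan.ext ?_ ?_)
  · simp [h]
  · simp [reassoc_of% graphFwd_ap φ]

lemma exists_graphLens (a : X ⟶ Y) : ∃ φ r, a = graphLens φ r := by
  induction a using lens_ind with | h f l r
  exact ⟨_, _, lens_eq_graphLens f l r rfl⟩

/-- Compares normal forms without transporting backward parts along `φ = ψ`: both are induced from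
the same `r` by span morphisms to the same `f`, so only the maps of apices have to agree.
Precomposing with `toGraph` gives both maps the source `(coalg X).left`, so that `h` makes sense
before `φ` and `ψ` are identified. -/
lemma normal_ext {f : X.base ⟶ Y.base} {φ ψ : (coalg X).left ⟶ (coalg Y).left} (e : φ = ψ)
    (m : graph φ ⟶ f) (n : graph ψ ⟶ f) (h : toGraph φ ≫ top m = toGraph ψ ≫ top n)
    (r : (ComodSpan.reindex f).obj (comod Y) ⟶ comod X) :
    (⟨φ, (ComodSpan.reindex₂ m).app (comod Y) ≫ r⟩ :
      Σ φ : (coalg X).left ⟶ (coalg Y).left,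
        ((ComodSpan.reindex (graph φ)).obj (comod Y) ⟶ comod X)) =
      ⟨ψ, (ComodSpan.reindex₂ n).app (comod Y) ≫ r⟩ := by
  subst e
  obtain rfl : m = n := by
    ext : 1
    rw [← Category.id_comp (top m), ← Category.id_comp (top n), ← ofGraph_toGraph,
      Category.assoc, Category.assoc, h]
  rfl

/-- The normal form of a pair. -/
noncomputable def normalLens (f : X.base ⟶ Y.base)
    (l : coalg X ⟶ (OverSpan.reindex f).obj (coalg Y))
    (r : (ComodSpan.reindex f).obj (comod Y) ⟶ comod X) :
    Σ φ : (coalg X).left ⟶ (coalg Y).left,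
      ((ComodSpan.reindex (graph φ)).obj (comod Y) ⟶ comod X) :=
  ⟨l.left ≫ OverSpan.pr f (coalg Y),
    (ComodSpan.reindex₂ (fromGraph l rfl)).app (comod Y) ≫ r⟩

/-- Makes the normal form well defined on the coend. Reindexing along `m` leaves the projection to
`coalg Y` alone, hence also `φ`, and composes the span morphism out of the graph with `m`;
functoriality of `reindex₂` does the rest. -/
lemma normalLens_slide {f g : X.base ⟶ Y.base} (m : f ⟶ g)
    (l : coalg X ⟶ (OverSpan.reindex f).obj (coalg Y))
    (r : (ComodSpan.reindex g).obj (comod Y) ⟶ comod X) :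
    normalLens g (l ≫ (OverSpan.reindex₂ m).app (coalg Y)) r =
      normalLens f l ((ComodSpan.reindex₂ m).app (comod Y) ≫ r) := by
  refine (normal_ext (by simp) _ (fromGraph l rfl ≫ m) (by simp) r).trans ?_
  rw [normalLens, ComodSpan.reindex₂_comp, Category.assoc]

/-- The normal form of a dependent lens. -/
noncomputable def normal (a : X ⟶ Y) : Σ φ : (coalg X).left ⟶ (coalg Y).left,
    ((ComodSpan.reindex (graph φ)).obj (comod Y) ⟶ comod X) :=
  Quot.lift (fun a : PreHom X Y => normalLens a.rep a.l a.r) (by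
    rintro _ _ ⟨m, l, r⟩
    exact normalLens_slide m l r) a

/-- The span morphism attached to the tautological forward part is the identity of the graph. With
`exists_graphLens` this makes lenses correspond bijectively to pairs of a `φ` and a backward part
over its graph. -/
lemma normal_graphLens (φ : (coalg X).left ⟶ (coalg Y).left)
    (r : (ComodSpan.reindex (graph φ)).obj (comod Y) ⟶ comod X) :
    normal (graphLens φ r) = ⟨φ, r⟩ := by
  refine (normal_ext (graphFwd_pr φ) _ (𝟙 (graph φ)) (by simp) r).trans ?_
  rw [ComodSpan.reindex₂_id, Category.id_comp]

lemma graphLens_injective (φ : (coalg X).left ⟶ (coalg Y).left) :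
    Function.Injective (graphLens φ) := fun r s h => by
  simpa [normal_graphLens] using congrArg normal h

lemma eq_of_graphLens_eq {φ ψ : (coalg X).left ⟶ (coalg Y).left}
    {r : (ComodSpan.reindex (graph φ)).obj (comod Y) ⟶ comod X}
    {s : (ComodSpan.reindex (graph ψ)).obj (comod Y) ⟶ comod X}
    (h : graphLens φ r = graphLens ψ s) : φ = ψ := by
  have := congrArg (fun a => (normal a).1) h
  simpa [normal_graphLens] using this

end

/-! ### Composition of lenses in normal form. -/

section
variable {X Y Z : DLens C} (φ : (coalg X).left ⟶ (coalg Y).left)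
  (ψ : (coalg Y).left ⟶ (coalg Z).left)

/-- The comparison of the graph of a composite with the composite of the graphs. -/
noncomputable def graphComp : graph (φ ≫ ψ) ⟶ graph φ ≫ graph ψ :=
  mkHom (SpanCat.lift (ofGraph _ ≫ toGraph φ) (ofGraph _ ≫ φ ≫ toGraph ψ)
    (by simp [left_graph, right_graph])) (by simp [left_graph]) (by simp [right_graph])

@[simp] lemma graphComp_p₁ :
    SpanCat.top (graphComp φ ψ) ≫ p₁ _ _ = ofGraph _ ≫ toGraph φ := by simp [graphComp]

@[simp] lemma graphComp_p₂ :
    SpanCat.top (graphComp φ ψ) ≫ p₂ _ _ = ofGraph _ ≫ φ ≫ toGraph ψ := by simp [graphComp]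

@[simp] lemma graphComp_p₁_assoc : type_of% (reassoc_of% @graphComp_p₁) :=
  @(reassoc_of% @graphComp_p₁)

/-- The graph of a composite is the composite of the graphs if the middle structure morphism is
an isomorphism. -/
lemma isIso_graphComp [Mono (coalg Y).hom] : IsIso (graphComp φ ψ) := by
  -- The apex of the composite span is the pullback of `φ ≫ (coalg Y).hom` and `(coalg Y).hom`.
  -- Cancelling the monomorphism `(coalg Y).hom` shows that the second projection is `φ` after the
  -- first.
  have h : p₂ (graph φ) (graph ψ) = p₁ (graph φ) (graph ψ) ≫ ofGraph φ ≫ φ ≫ toGraph ψ := by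
    have h := SpanCat.condition (graph φ) (graph ψ)
    rw [left_graph, right_graph] at h
    have h' : (p₁ (graph φ) (graph ψ) ≫ ofGraph φ ≫ φ) = p₂ (graph φ) (graph ψ) ≫ ofGraph ψ := by
      rw [← cancel_mono (coalg Y).hom]
      simpa using h
    have := congrArg (· ≫ toGraph ψ) h'
    simpa using this.symm
  -- So the first projection loses no information and is the inverse.
  refine ⟨mkHom (p₁ _ _ ≫ ofGraph φ ≫ toGraph _) ?_ ?_, ?_, ?_⟩
  · simp [left_graph]
  · simp [right_graph, h]
  · ext : 1
    simp
  · ext : 1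
    apply apex_ext
    · simp
    · simp [h]

/-- The composite is represented by `graph φ ≫ graph ψ`, and its forward part is the image of
`graphFwd (φ ≫ ψ)` under `graphComp φ ψ`. One use of the coend relation thus brings it to normal
form. No condition on the structure map of `Y` is needed here. -/
lemma graphLens_comp (r : (ComodSpan.reindex (graph φ)).obj (comod Y) ⟶ comod X)
    (s : (ComodSpan.reindex (graph ψ)).obj (comod Z) ⟶ comod Y) :
    graphLens φ r ≫ graphLens ψ s = graphLens (φ ≫ ψ)
      ((ComodSpan.reindex₂ (graphComp φ ψ)).app (comod Z) ≫
        ComodSpan.multHom (graph φ) (graph ψ) (comod Z) ≫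
        (ComodSpan.reindex (graph φ)).map s ≫ r) := by
  refine (lens_comp _ _ _ _ _ _).trans (lens_eq (graphComp φ ψ) ?_ rfl).symm
  -- This removes the inverse coherence isomorphism from the composite. What remains is an equality
  -- of maps to an iterated pullback, checked on its three projections.
  rw [← cancel_mono ((OverSpan.mult (graph φ) (graph ψ)).hom.app (coalg Z))]
  simp only [Category.assoc, Iso.inv_hom_id_app]
  refine Over.OverMorphism.ext (OverSpan.ext (OverSpan.ext ?_ ?_) ?_)
  · simp [reassoc_of% graphFwd_pr φ]
  · simp [reassoc_of% graphFwd_pr φ, reassoc_of% graphFwd_ap (φ ≫ ψ)]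
  · simp [reassoc_of% graphFwd_ap (φ ≫ ψ)]

end

end DLens

/-! ### The adjunction between restriction and extension of scalars. -/

namespace Comod

variable {C : Type u} [Category.{v} C] [MonoidalCategory C] [SymmetricCategory C]
  [HasCoreflexiveEqualizers C] [TensorPreservesCoreflexiveEqualizers C] {A M : CommComon C}

/-- Stated over `p ≫ 𝟙 A` so that `IsOver.from_push` turns it into a map out of the restriction of
`W`, over the identity of `A`. -/
lemma isOver_comp_proj {p : M ⟶ A} {W : Comod M} {Y : Comod A} (t : W ⟶ coextObj p Y) :
    IsOver (p ≫ 𝟙 A) W Y (t.hom ≫ proj p Y) :=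
  ((isOver_proj p Y).hom_comp t).congr (Category.comp_id p).symm rfl

/-- The transpose of a morphism under the adjunction between restriction and extension of
scalars. -/
noncomputable def pushHom {p : M ⟶ A} {W : Comod M} {Y : Comod A} (t : W ⟶ coextObj p Y) :
    (push p).obj W ⟶ Y := (isOver_comp_proj t).from_push.toHom

/-- Naturality of the transposition in the `M`-comodule. It identifies the backward part of a
composite lens with the transpose of a composite over the summand. -/
lemma pushHom_comp {p : M ⟶ A} {V W : Comod M} {Y : Comod A} (s : V ⟶ W)
    (t : W ⟶ coextObj p Y) : pushHom (s ≫ t) = (push p).map s ≫ pushHom t :=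
  hom_ext (Category.assoc s.hom t.hom (proj p Y))

/-- The cotensor product is the universal comodule with a map over `p` to `Y`. Injectivity holds
because comodule maps into it are determined by their composite with `proj`, surjectivity because
every map over `p` factors through `proj`. -/
lemma pushHom_bijective (p : M ⟶ A) (W : Comod M) (Y : Comod A) :
    Function.Bijective (pushHom : (W ⟶ coextObj p Y) → ((push p).obj W ⟶ Y)) := by
  refine ⟨fun s t h => hom_ext ?_, fun g => ?_⟩
  · exact ext_proj (isOver_hom s) (isOver_hom t) (congrArg Hom.hom h)
  · have h : IsOver (𝟙 M ≫ p) W Y g.hom := by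
      -- The identity is a map over `p` from `W` to its own restriction; composing it with `g` gives
      -- the map to be factored.
      have h₁ : IsOver p W ((push p).obj W) (𝟙 W.X) :=
        ((isOver_hom (𝟙 W)).to_push (q := p)).congr (Category.id_comp p) rfl
      exact (h₁.comp_hom g).congr (Category.id_comp p).symm (Category.id_comp g.hom)
    exact ⟨(isOver_fill h).toHom, hom_ext (fill_proj h)⟩

end Comod

/-! ### Coproducts of dependent lenses. -/

namespace DLens

open SpanCat Optic IndexedCat ComodAux

variable {C : Type u} [Category.{v} C] [MonoidalCategory C] [SymmetricCategory C]
  [HasCoreflexiveEqualizers C] [TensorPreservesCoreflexiveEqualizers C]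

section
variable {ι : Type w} {X : ι → DLens C} (c : Cofan fun i => (coalg (X i)).left) (N : Comod c.pt)

/-- The object `(Y, N)^Y`, where `Y` is the point of a cofan. -/
noncomputable def cofanPt : DLens C := of (Over.mk (𝟙 c.pt)) N

/-- Supplies the monomorphism required by `isIso_graphComp` when the middle object is `cofanPt c N`.
This is why the base of the coproduct is `c.pt` itself. -/
instance : IsIso (coalg (cofanPt c N)).hom := inferInstanceAs (IsIso (𝟙 c.pt))

/-- An inclusion of the cofan. -/
def cofanInj (i : ι) : (coalg (X i)).left ⟶ (coalg (cofanPt c N)).left := c.inj i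

-- The family `e` says that `N` glues the comodules of the summands, each extended along its
-- structure map. The right leg of the graph of an inclusion is `c.inj i` followed by the identity
-- of `c.pt`.
variable {c N}
  (e : ∀ i, Comod.coextObj (right (graph (cofanInj c N i))) N ≅
    Comod.coextObj (coalg (X i)).hom (comod (X i)))

/-- The backward part of the inclusion of a summand. -/
noncomputable def cofanBwd (i : ι) :
    (ComodSpan.reindex (graph (cofanInj c N i))).obj (comod (cofanPt c N)) ⟶ comod (X i) :=
  -- Reindexing along this graph extends `N` along the inclusion and then restricts along `(coalg (X
  -- i)).hom`, so maps from it to `comod (X i)` are transposes of maps like `e i`.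
  Comod.pushHom (p := (coalg (X i)).hom) (e i).hom

variable (c N) in
/-- Extension of scalars along the inclusions of the summands. -/
noncomputable def extend : Comod c.pt ⥤ ∀ i, Comod (coalg (X i)).left :=
  Functor.pi' fun i => Comod.coext (right (graph (cofanInj c N i)))

variable {Z : DLens C} (φ : (coalg (cofanPt c N)).left ⟶ (coalg Z).left)

/-- The backward part of the restriction of a lens to a summand. -/
noncomputable def restrictBwd (i : ι)
    (s : (ComodSpan.reindex (graph φ)).obj (comod Z) ⟶ comod (cofanPt c N)) :
    (ComodSpan.reindex (graph (cofanInj c N i ≫ φ))).obj (comod Z) ⟶ comod (X i) :=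
  (ComodSpan.reindex₂ (graphComp (cofanInj c N i) φ)).app (comod Z) ≫
    ComodSpan.multHom (graph (cofanInj c N i)) (graph φ) (comod Z) ≫
    (ComodSpan.reindex (graph (cofanInj c N i))).map s ≫ cofanBwd e i

/-- The backward half of the universal property. After transposition, restricting `s` to a summand
is extension of scalars applied to `s`, up to invertible maps; over all summands together this is
the action of `extend c N` on morphisms, which is fully faithful. -/
lemma restrictBwd_bijective [(extend c N).IsEquivalence] :
    Function.Bijective fun s i => restrictBwd e φ i s := by
  have h₁ : Function.Bijective fun
      (s : (ComodSpan.reindex (graph φ)).obj (comod Z) ⟶ comod (cofanPt c N)) i =>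
      (Comod.coext (right (graph (cofanInj c N i)))).map s :=
    (Functor.FullyFaithful.ofFullyFaithful (extend c N)).map_bijective _ _
  -- The remaining operations act on one summand at a time, and each is bijective: composition with
  -- `e i`, transposition, and precomposition with the comparison of the two reindexings and with
  -- `reindex₂` of `graphComp`. The last of these is invertible because `graphComp` is.
  have h₂ i : Function.Bijective fun
      (t : (Comod.coext (right (graph (cofanInj c N i)))).obj
        ((ComodSpan.reindex (graph φ)).obj (comod Z)) ⟶
        Comod.coextObj (right (graph (cofanInj c N i))) N) =>
      (ComodSpan.reindex₂ (graphComp (cofanInj c N i) φ)).app (comod Z) ≫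
        ComodSpan.multHom (graph (cofanInj c N i)) (graph φ) (comod Z) ≫
        Comod.pushHom (p := (coalg (X i)).hom) (t ≫ (e i).hom) := by
    have := isIso_graphComp (cofanInj c N i) φ
    have : IsIso ((ComodSpan.reindex₂ (graphComp (cofanInj c N i) φ)).app (comod Z)) :=
      ⟨(ComodSpan.reindex₂ (inv (graphComp (cofanInj c N i) φ))).app (comod Z),
        by rw [← ComodSpan.reindex₂_comp, IsIso.hom_inv_id, ComodSpan.reindex₂_id],
        by rw [← ComodSpan.reindex₂_comp, IsIso.inv_hom_id, ComodSpan.reindex₂_id]⟩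
    have : IsIso (ComodSpan.multHom (graph (cofanInj c N i)) (graph φ) (comod Z)) :=
      inferInstanceAs (IsIso ((ComodSpan.mult _ _).hom.app _))
    exact (((asIso ((ComodSpan.reindex₂ (graphComp (cofanInj c N i) φ)).app
      (comod Z))).homFromEquiv.symm.bijective.comp
      (asIso (ComodSpan.multHom (graph (cofanInj c N i)) (graph φ)
        (comod Z))).homFromEquiv.symm.bijective).comp
      (Comod.pushHom_bijective (coalg (X i)).hom _ _)).comp (e i).homToEquiv.bijective
  have h₃ := (Function.Bijective.piMap h₂).comp h₁
  convert h₃ using 1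
  -- Only naturality of the transposition separates the composite of the bijections from
  -- `restrictBwd`.
  funext s i
  exact congrArg (fun t => (ComodSpan.reindex₂ (graphComp (cofanInj c N i) φ)).app (comod Z) ≫
    ComodSpan.multHom (graph (cofanInj c N i)) (graph φ) (comod Z) ≫ t)
    (Comod.pushHom_comp ((Comod.coext (right (graph (cofanInj c N i)))).map s) (e i).hom).symm

/-- The inclusion of a summand. -/
noncomputable def inj (i : ι) : X i ⟶ cofanPt c N := graphLens (cofanInj c N i) (cofanBwd e i)

lemma inj_graphLens (i : ι)
    (s : (ComodSpan.reindex (graph φ)).obj (comod Z) ⟶ comod (cofanPt c N)) :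
    inj e i ≫ graphLens φ s = graphLens (cofanInj c N i ≫ φ) (restrictBwd e φ i s) :=
  graphLens_comp _ _ _ _

/-- In normal form the two halves separate: forward parts glue uniquely because `c` is a coproduct
of comonoids, and over a fixed `φ` backward parts glue uniquely by `restrictBwd_bijective`. -/
lemma existsUnique_desc [(extend c N).IsEquivalence] (hc : IsColimit c) (g : ∀ i, X i ⟶ Z) :
    ∃! a : cofanPt c N ⟶ Z, ∀ i, inj e i ≫ a = g i := by
  choose ψ t ht using fun i => exists_graphLens (g i)
  obtain ⟨φ, hφ⟩ : ∃ φ : (coalg (cofanPt c N)).left ⟶ (coalg Z).left,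
      ∀ i, cofanInj c N i ≫ φ = ψ i :=
    ⟨Cofan.IsColimit.desc hc ψ, fun i => Cofan.IsColimit.fac hc ψ i⟩
  -- The forward parts are replaced first, as the types of the backward parts `t` depend on them;
  -- `t` then lies in the target of the bijection.
  obtain rfl : (fun i => cofanInj c N i ≫ φ) = ψ := funext hφ
  have hb := restrictBwd_bijective e φ
  obtain ⟨s, hs⟩ := hb.2 t
  have hg i : g i = graphLens (cofanInj c N i ≫ φ) (restrictBwd e φ i s) :=
    (ht i).trans (congrArg _ (congrFun hs i).symm)
  refine ⟨graphLens φ s, fun i => (inj_graphLens e φ i s).trans (hg i).symm, fun a ha => ?_⟩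
  obtain ⟨φ', s', rfl⟩ := exists_graphLens a
  have h i := (inj_graphLens e φ' i s').symm.trans ((ha i).trans (hg i))
  -- Uniqueness of normal forms on each summand yields the forward parts; once these are identified,
  -- it also yields the restricted backward parts.
  obtain rfl : φ' = φ := Cofan.IsColimit.hom_ext hc _ _ fun i => eq_of_graphLens_eq (h i)
  exact congrArg _ (hb.1 (funext fun i => graphLens_injective _ (h i)))

end

/-- The equivalence is used twice: essential surjectivity produces the comodule of the coproduct,
and full faithfulness enters through `existsUnique_desc`. -/
lemma hasColimit_discrete {ι : Type w} (X : ι → DLens C) (c : Cofan fun i => (coalg (X i)).left)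
    (hc : IsColimit c) (h : (Functor.pi' fun i => Comod.coext (c.inj i)).IsEquivalence) :
    HasColimit (Discrete.functor X) := by
  have h' (N : Comod c.pt) : (extend c N).IsEquivalence := by
    have e : extend c N = Functor.pi' fun i => Comod.coext (c.inj i) :=
      congrArg Functor.pi' (funext fun i => congrArg Comod.coext (Category.comp_id (c.inj i)))
    rwa [e]
  -- `extend c N` mentions `N` through the object `cofanPt c N`, although the functor does not
  -- depend on it. `G` is the same functor without that parameter, so that it can be used to choose
  -- `N`.
  let G : Comod c.pt ⥤ ∀ i, Comod (coalg (X i)).left :=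
    Functor.pi' fun i => Comod.coext (c.inj i)
  have : G.IsEquivalence := h
  let W : ∀ i, Comod (coalg (X i)).left := fun i =>
    Comod.coextObj (coalg (X i)).hom (comod (X i))
  let N : Comod c.pt := G.objPreimage W
  -- The first factor only removes the identity of `c.pt` from the right leg of the graph.
  let e i : Comod.coextObj (right (graph (cofanInj c N i))) N ≅ W i :=
    eqToIso (congrArg (fun p => Comod.coextObj p N) (Category.comp_id (c.inj i))) ≪≫
      Pi.isoApp (G.objObjPreimageIso W) i
  exact ⟨⟨Cofan.mk (cofanPt c N) (inj e), IsColimit.ofExistsUnique fun s => by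
    simpa using existsUnique_desc e hc fun i => s.ι.app ⟨i⟩⟩⟩

end DLens

theorem mainTheorem6 {C : Type u} [Category.{v} C] [MonoidalCategory C] [SymmetricCategory C]
    [HasCoreflexiveEqualizers C] [TensorPreservesCoreflexiveEqualizers C] [HasFiniteCoproducts C]
    (h : ∀ (ι : Type) [Finite ι] (A : ι → CommComon C) (c : Cofan A), IsColimit c →
      (Functor.pi' fun i => Comod.coext (c.inj i)).IsEquivalence) :
    HasFiniteCoproducts (DLens C) := by
  refine ⟨fun n => ⟨fun F => ?_⟩⟩
  have : HasColimit (Discrete.functor (F.obj ∘ Discrete.mk)) :=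
    -- The hypothesis is applied to the comonoids underlying the forward objects, not to the bases.
    -- The empty family is the case `n = 0`.
    DLens.hasColimit_discrete (fun i => F.obj ⟨i⟩) _ (ComodAux.isColimitSigmaCofan _)
      (h _ _ _ (ComodAux.isColimitSigmaCofan _))
  exact hasColimit_of_iso Discrete.natIsoFunctor
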